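/- Let $d>1$ be a cube-free integer, $L=\mathbb{Q}(\sqrt[3]{d})$ the corresponding pure cubic field, $\zeta_3$ a primitive cube root of unity, $k_0=\mathbb{Q}(\zeta_3)$, $k=\mathbb{Q}(\sqrt[3]{d},\zeta_3)$ the normal closure of $L$, and $G=\operatorname{Gal}(k/k_0)$. For a number field $F$ let $E_F$, $\mathcal{I}_F$ and $\mathcal{P}_F$ denote the unit group of the ring of integers $\mathcal{O}_F$, the group of nonzero fractional ideals and the group of nonzero principal fractional ideals of $F$; for $F\subseteq F'$ regard $\mathcal{I}_F$ as a subgroup of $\mathcal{I}_{F'}$ by extension of ideals. Let $\mathcal{P}_k^G$ be the group of $G$-invariant principal fractional ideals of $k$, and $\mathcal{P}_L^G$ the group of principal fractional ideals of $L$ whose extension to $k$ is $G$-invariant. Let $\ker(N_{k/L})\cap(\mathcal{P}_k^G/\mathcal{P}_{k_0})$ be the group of classes in $\mathcal{P}_k^G/\mathcal{P}_{k_0}$ of those ideals whose relative norm to $L$ lies in $\mathcal{I}_{\mathbb{Q}}$. Let $t$ be the number of prime ideals of $k_0$ that ramify in $k$, and let $2s$ be the number of those among them that lie over rational primes which split in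 $k_0/\mathbb{Q}$ (this number is even). Then there are integers $U,A,R\ge 0$ such that $$3^U=(E_{k_0}:N_{k/k_0}(E_k)),\qquad 3^A=\#(\mathcal{P}_L^G/\mathcal{P}_{\mathbb{Q}}),\qquad 3^R=\#\bigl(\ker(N_{k/L})\cap(\mathcal{P}_k^G/\mathcal{P}_{k_0})\bigr),$$ and $L$ belongs to precisely one of the following three principal factorization types: type $\alpha$, with $(U;A,R)=(1;1,1)$; type $\beta$, with $(U;A,R)=(1;2,0)$; type $\gamma$, with $(U;A,R)=(0;1,0)$. The invariants satisfy the equation $A+R=U+1$ and the estimates $1\le A+R\le t$, $1\le A\le t-s$ and $0\le R\le s$. For each type, the group $\mathcal{P}_L^G/\mathcal{P}_{\mathbb{Q}}$ contains the subgroup $\Delta$ generated by the class of the principal ideal $\sqrt[3]{d}\,\mathcal{O}_L$, and $\Delta$ has order $3$. -/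

import Mathlib

open scoped NumberField nonZeroDivisors

noncomputable section

namespace PureCubic

/-- `𝓘_F`: the group of nonzero fractional ideals of the number field `F`. -/
abbrev IdealGroup (F : Type*) [Field F] [NumberField F] : Type _ :=
  (FractionalIdeal (𝓞 F)⁰ F)ˣ

/-- `𝓟_F`: the group of nonzero principal fractional ideals of `F`. -/
abbrev principalIdeals (F : Type*) [Field F] [NumberField F] : Subgroup (IdealGroup F) :=
  (toPrincipalIdeal (𝓞 F) F).range

section Extension

variable (F E : Type*) [Field F] [NumberField F] [Field E] [NumberField E] [Algebra F E]

/-- Extension of ideals `𝓘_F → 𝓘_E`, `𝔞 ↦ 𝔞 𝓞_E`. -/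
def idealExt : IdealGroup F →* IdealGroup E :=
  Units.map (FractionalIdeal.extendedHom (A := 𝓞 F) (K := F) E (𝓞 E)).toMonoidHom

/-- `𝓘_F` regarded as a subgroup of `𝓘_E`. -/
def extendedIdeals : Subgroup (IdealGroup E) := (idealExt F E).range

/-- `𝓟_F` regarded as a subgroup of `𝓘_E`. -/
def extendedPrincipalIdeals : Subgroup (IdealGroup E) :=
  (principalIdeals F).map (idealExt F E)

/-- The norm of a fractional ideal `𝔞/b`, extending `Ideal.relNorm` multiplicatively. -/
def fracRelNormFun (I : FractionalIdeal (𝓞 E)⁰ E) : FractionalIdeal (𝓞 F)⁰ F :=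
  (Ideal.relNorm (𝓞 F) I.num : FractionalIdeal (𝓞 F)⁰ F) /
    (Ideal.relNorm (𝓞 F) (Ideal.span {(I.den : 𝓞 E)}) : FractionalIdeal (𝓞 F)⁰ F)

theorem mul_den_eq_num (I : FractionalIdeal (𝓞 E)⁰ E) :
    I * (Ideal.span {(I.den : 𝓞 E)} : Ideal (𝓞 E)) = (I.num : FractionalIdeal (𝓞 E)⁰ E) := by
  have h := FractionalIdeal.den_mul_self_eq_num' (𝓞 E)⁰ E I
  rw [← h, FractionalIdeal.coeIdeal_span_singleton, mul_comm]

/-- The norm does not depend on the way in which the ideal is written as a fraction. -/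
theorem fracRelNormFun_eq (I : FractionalIdeal (𝓞 E)⁰ E) (A B : Ideal (𝓞 E)) (hB : B ≠ ⊥)
    (h : I * (B : FractionalIdeal (𝓞 E)⁰ E) = A) :
    fracRelNormFun F E I = (Ideal.relNorm (𝓞 F) A : FractionalIdeal (𝓞 F)⁰ F) /
      (Ideal.relNorm (𝓞 F) B : FractionalIdeal (𝓞 F)⁰ F) := by
  have hden : Ideal.span {(I.den : 𝓞 E)} ≠ ⊥ := by
    simp
  have key : I.num * B = A * Ideal.span {(I.den : 𝓞 E)} := by
    apply FractionalIdeal.coeIdeal_injective (K := E)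
    simp only [FractionalIdeal.coeIdeal_mul]
    rw [← mul_den_eq_num, ← h]
    ring
  unfold fracRelNormFun
  rw [div_eq_div_iff]
  · rw [← FractionalIdeal.coeIdeal_mul, ← FractionalIdeal.coeIdeal_mul, ← map_mul, ← map_mul, key]
  · rw [Ne, FractionalIdeal.coeIdeal_eq_zero, Ideal.relNorm_eq_bot_iff]
    exact hden
  · rw [Ne, FractionalIdeal.coeIdeal_eq_zero, Ideal.relNorm_eq_bot_iff]
    exact hB

/-- The relative norm of fractional ideals as a homomorphism. -/
def fracRelNorm : FractionalIdeal (𝓞 E)⁰ E →* FractionalIdeal (𝓞 F)⁰ F where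
  toFun := fracRelNormFun F E
  map_one' := by
    rw [fracRelNormFun_eq F E 1 ⊤ ⊤ (by simp) (by simp)]
    simp
  map_mul' I J := by
    rw [fracRelNormFun_eq F E (I * J) (I.num * J.num)
      (Ideal.span {(I.den : 𝓞 E)} * Ideal.span {(J.den : 𝓞 E)})]
    · simp only [fracRelNormFun, map_mul, FractionalIdeal.coeIdeal_mul]
      rw [div_mul_div_comm]
    · simp [Ideal.span_singleton_mul_span_singleton]
    · simp only [FractionalIdeal.coeIdeal_mul, ← mul_den_eq_num]
      ring

/-- The relative norm `N_{E/F} : 𝓘_E → 𝓘_F`. -/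
def idealNorm : IdealGroup E →* IdealGroup F := Units.map (fracRelNorm F E)

/-- The relative norm `N_{E/F} : E_E → E_F` on unit groups. -/
def unitNorm : (𝓞 E)ˣ →* (𝓞 F)ˣ := Units.map (RingOfIntegers.norm F)

/-- The unit norm index `(E_F : N_{E/F}(E_E))`. -/
def unitNormIndex : ℕ := (unitNorm F E).range.index

end Extension

/-- The action of an automorphism `g` of `k` on ideals, `𝔞 ↦ g(𝔞)`. -/
def galIdeal {k : Type*} [Field k] [NumberField k] (g : k ≃+* k) : IdealGroup k ≃* IdealGroup k :=
  Units.mapEquiv (FractionalIdeal.ringEquivOfRingEquiv k k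
    (NumberField.RingOfIntegers.mapRingEquiv g)).toMulEquiv

section Invariants

variable (k₀ L k : Type*) [Field k₀] [NumberField k₀] [Field L] [NumberField L]
  [Field k] [NumberField k] [Algebra k₀ k] [Algebra L k]

/-- `𝓘_k^G`: the ideals of `k` invariant under `G = Gal(k/k₀)`. -/
def ambiguousIdeals : Subgroup (IdealGroup k) where
  carrier := {I | ∀ g : k ≃ₐ[k₀] k, galIdeal g.toRingEquiv I = I}
  mul_mem' := fun ha hb g => by rw [map_mul, ha g, hb g]
  one_mem' := fun g => map_one _
  inv_mem' := fun ha g => by rw [map_inv, ha g]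

/-- `𝓟_k^G`: the ambiguous principal ideals of `k/k₀`. -/
def ambiguousPrincipalIdeals : Subgroup (IdealGroup k) :=
  principalIdeals k ⊓ ambiguousIdeals k₀ k

/-- `𝓟_L^G`: the principal ideals of `L` whose extension to `k` is invariant under
`G = Gal(k/k₀)`. -/
def absoluteAmbiguousPrincipalIdeals : Subgroup (IdealGroup L) :=
  principalIdeals L ⊓ (ambiguousIdeals k₀ k).comap (idealExt L k)

/-- `𝓟_L^G / 𝓟_ℚ`: the group of absolute principal factors. -/
abbrev AbsolutePrincipalFactors : Type _ :=
  absoluteAmbiguousPrincipalIdeals k₀ L k ⧸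
    (extendedPrincipalIdeals ℚ L).subgroupOf (absoluteAmbiguousPrincipalIdeals k₀ L k)

/-- The ambiguous principal ideals `𝔞` of `k/k₀` with trivial norm `N_{k/L}(𝔞)` in
`𝓘_L / 𝓘_ℚ`. -/
def relativeAmbiguousPrincipalIdeals : Subgroup (IdealGroup k) :=
  ambiguousPrincipalIdeals k₀ k ⊓
    ((QuotientGroup.mk' (extendedIdeals ℚ L)).comp (idealNorm L k)).ker

/-- `ker(N_{k/L}) ∩ (𝓟_k^G / 𝓟_{k₀})`: the group of relative principal factors. -/
abbrev RelativePrincipalFactors : Type _ :=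
  relativeAmbiguousPrincipalIdeals k₀ L k ⧸
    (extendedPrincipalIdeals k₀ k).subgroupOf (relativeAmbiguousPrincipalIdeals k₀ L k)

/-- The nonzero prime ideals of `k₀` which ramify in `k`. -/
def ramifiedPrimes : Set (IsDedekindDomain.HeightOneSpectrum (𝓞 k₀)) :=
  {v | ∃ P ∈ v.asIdeal.primesOver (𝓞 k), 1 < P.ramificationIdx (𝓞 k₀)}

/-- The primes of `k₀` lying over rational primes which split completely in `k₀/ℚ`. -/
def splitPrimes : Set (IsDedekindDomain.HeightOneSpectrum (𝓞 k₀)) :=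
  {v | ((v.asIdeal.under ℤ).primesOver (𝓞 k₀)).ncard = Module.finrank ℚ k₀}

end Invariants

/-- The three principal factorization types. -/
inductive PFType
  | alpha
  | beta
  | gamma

/-- The triple `(U, A, R)` that characterizes a principal factorization type. -/
def PFType.invariants : PFType → ℕ × ℕ × ℕ
  | .alpha => (1, 1, 1)
  | .beta => (1, 2, 0)
  | .gamma => (0, 1, 0)

end PureCubic

end

/-!
The norm `N_{k/L}` maps `𝓟_k^G / 𝓟_{k₀}` to `𝓟_L^G / 𝓟_ℚ` with kernel the group of relative
principal factors, and it is onto because `N_{k/L}(𝔞 𝓞_k) = 𝔞 ^ 2` while the target is killed by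
`3`; hence `3 ^ (A + R) = (𝓟_k^G : 𝓟_{k₀})`.

By Hilbert 90, applied to a generator `σ` of `G`, this index equals `(ker N_{k/k₀} : E_k ^ (σ - 1))`
inside `E_k`. On `E_k` modulo torsion `σ ^ 2 + σ + 1 = 0`, so `(σ - 1) ^ 2 = -3 σ` there and the
square of `det (σ - 1)` is `3` to the rank of `E_k`, up to sign. As the rank is `2`, this gives
`(𝓟_k^G : 𝓟_{k₀}) = 3 (E_{k₀} : N E_k)`, that is `A + R = U + 1`, and `U ≤ 1` because `E_{k₀}`
has order `6`.

An ambiguous ideal comes from `k₀` as soon as the orders of its norm to `k₀` at the ramified primes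
are divisible by `3`. For an ideal extended from `L` these orders agree at conjugate primes, and for
a relative principal factor they add up to `0` modulo `3`; so in the former case one prime of each
conjugate pair may be dropped, and in the latter one prime of each pair suffices. Finally `∛d 𝓞_L`
has order `3` since `d` is not a cube, so `A ≥ 1`, and only the three types remain.
-/

noncomputable section

namespace PureCubic

open IsDedekindDomain

section Order

variable {F : Type*} [Field F] [NumberField F]

/-- The exponent of the prime `v` in the factorization of a nonzero fractional ideal. -/
def ord (v : HeightOneSpectrum (𝓞 F)) (I : IdealGroup F) : ℤ :=
  FractionalIdeal.count F v (I : FractionalIdeal (𝓞 F)⁰ F)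

theorem ord_mul (v : HeightOneSpectrum (𝓞 F)) (I J : IdealGroup F) :
    ord v (I * J) = ord v I + ord v J :=
  FractionalIdeal.count_mul F v I.ne_zero J.ne_zero

theorem ord_pow (v : HeightOneSpectrum (𝓞 F)) (n : ℕ) (I : IdealGroup F) :
    ord v (I ^ n) = n * ord v I :=
  FractionalIdeal.count_pow F v n I

theorem ord_one (v : HeightOneSpectrum (𝓞 F)) : ord v (1 : IdealGroup F) = 0 :=
  FractionalIdeal.count_one F v

theorem ord_inv (v : HeightOneSpectrum (𝓞 F)) (I : IdealGroup F) : ord v I⁻¹ = -ord v I := by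
  rw [← add_eq_zero_iff_eq_neg, ← ord_mul, inv_mul_cancel, ord_one]

/-- A nonzero prime ideal as an element of the group of fractional ideals. -/
def primeIdeal (v : HeightOneSpectrum (𝓞 F)) : IdealGroup F :=
  Units.mk0 (v.asIdeal : FractionalIdeal (𝓞 F)⁰ F) (FractionalIdeal.coeIdeal_ne_zero.2 v.ne_bot)

theorem ord_primeIdeal [DecidableEq (HeightOneSpectrum (𝓞 F))] (v w : HeightOneSpectrum (𝓞 F)) :
    ord v (primeIdeal w) = if w = v then 1 else 0 :=
  FractionalIdeal.count_maximal F v w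

theorem finite_mulSupport_primeIdeal_zpow_ord (I : IdealGroup F) :
    (Function.mulSupport fun v => primeIdeal v ^ ord v I).Finite :=
  (Filter.eventually_cofinite.1
    (FractionalIdeal.finite_factors (I : FractionalIdeal (𝓞 F)⁰ F))).subset
    fun v hv h0 => hv (by simp [ord, h0])

theorem finprod_primeIdeal_zpow_ord (I : IdealGroup F) : ∏ᶠ v, primeIdeal v ^ ord v I = I := by
  apply Units.ext
  rw [← Units.coeHom_apply,
    MonoidHom.map_finprod (Units.coeHom _) (finite_mulSupport_primeIdeal_zpow_ord I)]
  simp only [Units.coeHom_apply, Units.val_zpow_eq_zpow_val]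
  exact FractionalIdeal.finprod_heightOneSpectrum_factorization' F I.ne_zero

theorem ord_ext {I J : IdealGroup F} (h : ∀ v, ord v I = ord v J) : I = J := by
  rw [← finprod_primeIdeal_zpow_ord I, ← finprod_primeIdeal_zpow_ord J]
  simp only [h]

instance : IsMulTorsionFree (IdealGroup F) where
  pow_left_injective n hn I J h := ord_ext fun v => by
    have := congrArg (ord v) h
    simpa only [ord_pow, mul_eq_mul_left_iff, Nat.cast_eq_zero, hn, or_false] using this

theorem exists_pow_eq_of_dvd_ord {n : ℕ} (hn : n ≠ 0) (I : IdealGroup F)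
    (h : ∀ v, (n : ℤ) ∣ ord v I) : ∃ J : IdealGroup F, J ^ n = I := by
  choose m hm using h
  have hpow (v) : primeIdeal v ^ ord v I = (primeIdeal v ^ m v) ^ n := by
    rw [hm, mul_comm, zpow_mul, zpow_natCast]
  have hfin := finite_mulSupport_primeIdeal_zpow_ord I
  simp only [hpow, Function.mulSupport, ne_eq, pow_eq_one_iff_left hn] at hfin
  refine ⟨∏ᶠ v, primeIdeal v ^ m v, ?_⟩
  rw [finprod_pow hfin, ← finprod_primeIdeal_zpow_ord I]
  simp only [hpow]

theorem closure_range_primeIdeal : Subgroup.closure (Set.range (primeIdeal (F := F))) = ⊤ := by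
  refine (Subgroup.eq_top_iff' _).2 fun I => ?_
  rw [← finprod_primeIdeal_zpow_ord I]
  exact finprod_induction (· ∈ Subgroup.closure _) (one_mem _) (fun _ _ => mul_mem)
    fun v => zpow_mem (Subgroup.subset_closure (Set.mem_range_self v)) _

@[elab_as_elim]
theorem prime_induction {p : IdealGroup F → Prop} (I : IdealGroup F)
    (prime : ∀ v, p (primeIdeal v)) (one : p 1) (mul : ∀ I J, p I → p J → p (I * J))
    (inv : ∀ I, p I → p I⁻¹) : p I := by
  have hI : I ∈ Subgroup.closure (Set.range (primeIdeal (F := F))) :=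
    closure_range_primeIdeal (F := F) ▸ Subgroup.mem_top I
  induction hI using Subgroup.closure_induction with
  | mem _ h => obtain ⟨v, rfl⟩ := h; exact prime v
  | one => exact one
  | mul I J _ _ hI hJ => exact mul I J hI hJ
  | inv I _ hI => exact inv I hI

end Order

section Principal

variable {F : Type*} [Field F] [NumberField F]

theorem ker_toPrincipalIdeal :
    (toPrincipalIdeal (𝓞 F) F).ker = (Units.map (algebraMap (𝓞 F) F : 𝓞 F →* F)).range := by
  ext x
  rw [MonoidHom.mem_ker, toPrincipalIdeal_eq_iff, Units.val_one,
    ← FractionalIdeal.spanSingleton_one, eq_comm, FractionalIdeal.spanSingleton_eq_spanSingleton]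
  simp only [MonoidHom.mem_range, Units.ext_iff, Units.smul_def, Algebra.smul_def, mul_one,
    Units.coe_map, MonoidHom.coe_coe]

theorem toPrincipalIdeal_surjective [IsPrincipalIdealRing (𝓞 F)] :
    Function.Surjective (toPrincipalIdeal (𝓞 F) F) := fun I => by
  obtain ⟨x, hx⟩ := (FractionalIdeal.isPrincipal_iff (I : FractionalIdeal (𝓞 F)⁰ F)).1 inferInstance
  exact mem_principal_ideals_iff.2 ⟨x, hx.symm⟩

theorem exists_pow_mem_principalIdeals :
    ∃ n ≠ 0, ∀ I : IdealGroup F, I ^ n ∈ principalIdeals F := by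
  refine ⟨Nat.card (ClassGroup (𝓞 F)), Nat.card_pos.ne', fun I => ?_⟩
  rw [← QuotientGroup.eq_one_iff, QuotientGroup.mk_pow,
    ← Nat.card_congr (ClassGroup.equiv (R := 𝓞 F) F).symm.toEquiv]
  exact pow_card_eq_one'

/-- Some power of every ideal is principal and ideals are torsion-free, so an identity between
homomorphisms of ideal groups reduces to an identity between elements. -/
theorem hom_ext_principal {M : Type*} [Monoid M] [IsMulTorsionFree M] {f g : IdealGroup F →* M}
    (h : ∀ x, f (toPrincipalIdeal (𝓞 F) F x) = g (toPrincipalIdeal (𝓞 F) F x)) : f = g := by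
  obtain ⟨n, hn, hpow⟩ := exists_pow_mem_principalIdeals (F := F)
  ext I
  obtain ⟨x, hx⟩ := hpow I
  refine IsMulTorsionFree.pow_left_injective hn ?_
  simpa only [map_pow, hx] using h x

end Principal

section Maps

variable (F E : Type*) [Field F] [NumberField F] [Field E] [NumberField E] [Algebra F E]

theorem idealExt_toPrincipalIdeal (x : Fˣ) :
    idealExt F E (toPrincipalIdeal (𝓞 F) F x) =
      toPrincipalIdeal (𝓞 E) E (Units.map (algebraMap F E : F →* E) x) := by
  have hmap : IsFractionRing.map (FaithfulSMul.algebraMap_injective (𝓞 F) (𝓞 E)) =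
      algebraMap F E := by
    refine IsLocalization.ringHom_ext (𝓞 F)⁰ (RingHom.ext fun a => ?_)
    rw [RingHom.comp_apply, IsFractionRing.map, IsLocalization.map_eq]
    rfl
  apply Units.ext
  rw [coe_toPrincipalIdeal]
  rw [idealExt, Units.coe_map, coe_toPrincipalIdeal]
  exact (FractionalIdeal.extendedHom_spanSingleton ..).trans
    (congrArg (FractionalIdeal.spanSingleton (𝓞 E)⁰) (RingHom.congr_fun hmap x))

theorem idealExt_injective : Function.Injective (idealExt F E) :=
  Units.map_injective (FractionalIdeal.extendedHom_injective (𝓞 F) F E (𝓞 E))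

theorem idealNorm_toPrincipalIdeal (x : Eˣ) :
    idealNorm F E (toPrincipalIdeal (𝓞 E) E x) =
      toPrincipalIdeal (𝓞 F) F (Units.map (Algebra.norm F : E →* F) x) := by
  obtain ⟨a, b, hb, hx⟩ := IsFractionRing.div_surjective (A := 𝓞 E) (x : E)
  have hbE : algebraMap (𝓞 E) E b ≠ 0 := by simpa using nonZeroDivisors.ne_zero hb
  have hnorm : Algebra.norm F (x : E) =
      Algebra.norm F (algebraMap (𝓞 E) E a) / Algebra.norm F (algebraMap (𝓞 E) E b) := by
    rw [← hx, div_eq_mul_inv, map_mul, Algebra.norm_inv, div_eq_mul_inv]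
  apply Units.ext
  rw [coe_toPrincipalIdeal, idealNorm, Units.coe_map, coe_toPrincipalIdeal]
  change fracRelNormFun F E (FractionalIdeal.spanSingleton (𝓞 E)⁰ (x : E)) =
    FractionalIdeal.spanSingleton (𝓞 F)⁰ (Algebra.norm F (x : E))
  rw [fracRelNormFun_eq F E _ (Ideal.span {a}) (Ideal.span {b})
    (by simpa using nonZeroDivisors.ne_zero hb)]
  · simp only [Ideal.relNorm_singleton, FractionalIdeal.coeIdeal_span_singleton,
      Algebra.algebraMap_intNorm (L := E) (K := F), FractionalIdeal.spanSingleton_div_spanSingleton,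
      hnorm]
  · rw [FractionalIdeal.coeIdeal_span_singleton, FractionalIdeal.coeIdeal_span_singleton,
      FractionalIdeal.spanSingleton_mul_spanSingleton, ← hx, div_mul_cancel₀ _ hbE]

variable {F}

theorem galIdeal_toPrincipalIdeal (g : F ≃+* F) (x : Fˣ) :
    galIdeal g (toPrincipalIdeal (𝓞 F) F x) =
      toPrincipalIdeal (𝓞 F) F (Units.map (g : F →* F) x) := by
  have hg : (IsFractionRing.ringEquivOfRingEquiv (K := F) (L := F)
      (NumberField.RingOfIntegers.mapRingEquiv g) : F →+* F) = g :=
    IsLocalization.ringHom_ext (𝓞 F)⁰ (RingHom.ext fun a =>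
      IsFractionRing.ringEquivOfRingEquiv_algebraMap _ a)
  apply Units.ext
  rw [coe_toPrincipalIdeal, galIdeal, Units.coe_mapEquiv, coe_toPrincipalIdeal]
  exact (FractionalIdeal.ringEquivOfRingEquiv_spanSingleton F F _ (x : F)).trans
    (congrArg (FractionalIdeal.spanSingleton (𝓞 F)⁰) (RingHom.congr_fun hg x))

/-- The action of an automorphism of `F` on the nonzero primes of `F`. -/
def galPrime (g : F ≃+* F) : HeightOneSpectrum (𝓞 F) ≃ HeightOneSpectrum (𝓞 F) :=
  HeightOneSpectrum.equivOfRingEquiv (NumberField.RingOfIntegers.mapRingEquiv g)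

theorem galIdeal_primeIdeal (g : F ≃+* F) (v : HeightOneSpectrum (𝓞 F)) :
    galIdeal g (primeIdeal v) = primeIdeal (galPrime g v) := by
  let e := NumberField.RingOfIntegers.mapRingEquiv g
  have he := FractionalIdeal.ringEquivOfRingEquiv_apply_val F F e v.asIdeal
  refine Units.ext (FractionalIdeal.coeToSubmodule_injective (he.trans ?_))
  ext x
  change (∃ y, (y ∈ (v.asIdeal : FractionalIdeal (𝓞 F)⁰ F)) ∧ _ = x) ↔
    x ∈ ((v.asIdeal.comap e.symm : Ideal (𝓞 F)) : FractionalIdeal (𝓞 F)⁰ F)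
  simp only [FractionalIdeal.mem_coeIdeal, Ideal.mem_comap]
  constructor
  · rintro ⟨_, ⟨a, ha, rfl⟩, rfl⟩
    refine ⟨e a, by simpa using ha, ?_⟩
    exact (IsFractionRing.semilinearEquivOfRingEquiv_algebraMap F F e a).symm
  · rintro ⟨b, hb, rfl⟩
    refine ⟨_, ⟨e.symm b, hb, rfl⟩, ?_⟩
    exact (IsFractionRing.semilinearEquivOfRingEquiv_algebraMap F F e _).trans (by simp)

theorem ord_galPrime_galIdeal (g : F ≃+* F) (v : HeightOneSpectrum (𝓞 F)) (I : IdealGroup F) :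
    ord (galPrime g v) (galIdeal g I) = ord v I := by
  classical
  induction I using prime_induction with
  | prime w => simp only [galIdeal_primeIdeal, ord_primeIdeal, EmbeddingLike.apply_eq_iff_eq]
  | one => simp only [map_one, ord_one]
  | mul I J hI hJ => simp only [map_mul, ord_mul, hI, hJ]
  | inv I hI => simp only [map_inv, ord_inv, hI]

variable (F)

theorem ord_idealExt (v : HeightOneSpectrum (𝓞 F)) (w : HeightOneSpectrum (𝓞 E))
    [hvw : w.asIdeal.LiesOver v.asIdeal] (I : IdealGroup F) :
    ord w (idealExt F E I) = w.asIdeal.ramificationIdx (𝓞 F) * ord v I := by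
  classical
  induction I using prime_induction with
  | prime u =>
    have hu : u.asIdeal.map (algebraMap (𝓞 F) (𝓞 E)) ≠ ⊥ := Ideal.map_ne_bot_of_ne_bot u.ne_bot
    have hcount : ord w (idealExt F E (primeIdeal u)) =
        ((UniqueFactorizationMonoid.normalizedFactors
          (u.asIdeal.map (algebraMap (𝓞 F) (𝓞 E)))).count w.asIdeal : ℤ) := by
      change FractionalIdeal.count E w (FractionalIdeal.extendedHom E (𝓞 E)
        (u.asIdeal : FractionalIdeal (𝓞 F)⁰ F)) = _
      rw [FractionalIdeal.extendedHom_coeIdeal_eq_map, FractionalIdeal.count_coe E w hu,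
        Ideal.count_associates_factors_eq hu w.isPrime w.ne_bot]
    rw [hcount, ord_primeIdeal]
    split_ifs with huv
    · subst huv
      rw [mul_one, Ideal.IsDedekindDomain.ramificationIdx_eq_normalizedFactors_count u.asIdeal _ hu]
    · rw [mul_zero, Nat.cast_eq_zero, Multiset.count_eq_zero]
      intro hmem
      have hwu : w.asIdeal.LiesOver u.asIdeal := (Ideal.liesOver_iff_dvd_map w.isPrime.ne_top).2
        (UniqueFactorizationMonoid.dvd_of_mem_normalizedFactors hmem)
      exact huv (HeightOneSpectrum.ext (hwu.over.trans hvw.over.symm))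
  | one => simp only [map_one, ord_one, mul_zero]
  | mul I J hI hJ => simp only [map_mul, ord_mul, hI, hJ, mul_add]
  | inv I hI => simp only [map_inv, ord_inv, hI, mul_neg]

theorem dvd_ord_of_idealExt_eq_pow {v : HeightOneSpectrum (𝓞 F)} (hv : v ∉ ramifiedPrimes F E)
    {n : ℕ} {J : IdealGroup F} {I : IdealGroup E} (h : idealExt F E J = I ^ n) :
    (n : ℤ) ∣ ord v J := by
  obtain ⟨⟨P, hP, hPv⟩⟩ := v.asIdeal.nonempty_primesOver (S := 𝓞 E)
  let w : HeightOneSpectrum (𝓞 E) := ⟨P, hP, Ideal.ne_bot_of_liesOver_of_ne_bot v.ne_bot P⟩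
  have : w.asIdeal.LiesOver v.asIdeal := hPv
  have he : P.ramificationIdx (𝓞 F) = 1 :=
    le_antisymm (not_lt.1 fun h1 => hv ⟨P, ⟨hP, hPv⟩, h1⟩) (Ideal.ramificationIdx_pos P (𝓞 F))
  refine ⟨ord w I, ?_⟩
  rw [← ord_pow, ← h, ord_idealExt F E v w, he, Nat.cast_one, one_mul]

theorem ramifiedPrimes_finite : (ramifiedPrimes F E).Finite := by
  have hfin := Ideal.finite_factors (I := differentIdeal (𝓞 F) (𝓞 E)) differentIdeal_ne_bot
  refine Set.Finite.of_finite_image (f := HeightOneSpectrum.asIdeal)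
    ((hfin.image fun w => w.asIdeal.under (𝓞 F)).subset ?_) fun v _ w _ h => HeightOneSpectrum.ext h
  rintro _ ⟨v, ⟨P, ⟨hP, hPv⟩, hram⟩, rfl⟩
  refine ⟨⟨P, hP, Ideal.ne_bot_of_liesOver_of_ne_bot v.ne_bot P⟩,
    dvd_differentIdeal_iff.2 fun hun => ?_, hPv.over.symm⟩
  exact hram.ne' (Ideal.ramificationIdx_eq_one P (𝓞 F))

end Maps

section Identities

variable (F E : Type*) [Field F] [NumberField F] [Field E] [NumberField E] [Algebra F E]

theorem idealExt_mem_principalIdeals {I : IdealGroup F} (hI : I ∈ principalIdeals F) :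
    idealExt F E I ∈ principalIdeals E := by
  obtain ⟨x, rfl⟩ := hI
  exact ⟨_, (idealExt_toPrincipalIdeal F E x).symm⟩

theorem idealNorm_mem_principalIdeals {I : IdealGroup E} (hI : I ∈ principalIdeals E) :
    idealNorm F E I ∈ principalIdeals F := by
  obtain ⟨x, rfl⟩ := hI
  exact ⟨_, (idealNorm_toPrincipalIdeal F E x).symm⟩

theorem idealExt_idealExt (K : Type*) [Field K] [NumberField K] [Algebra F K] [Algebra E K]
    [IsScalarTower F E K] (I : IdealGroup F) :
    idealExt E K (idealExt F E I) = idealExt F K I := by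
  refine DFunLike.congr_fun (hom_ext_principal (f := (idealExt E K).comp (idealExt F E))
    fun x => ?_) I
  rw [MonoidHom.comp_apply, idealExt_toPrincipalIdeal, idealExt_toPrincipalIdeal,
    idealExt_toPrincipalIdeal]
  exact congrArg _ (Units.ext (IsScalarTower.algebraMap_apply F E K x).symm)

theorem idealNorm_idealNorm (K : Type*) [Field K] [NumberField K] [Algebra F K] [Algebra E K]
    [IsScalarTower F E K] (I : IdealGroup K) :
    idealNorm F E (idealNorm E K I) = idealNorm F K I := by
  refine DFunLike.congr_fun (hom_ext_principal (f := (idealNorm F E).comp (idealNorm E K))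
    fun x => ?_) I
  rw [MonoidHom.comp_apply, idealNorm_toPrincipalIdeal, idealNorm_toPrincipalIdeal,
    idealNorm_toPrincipalIdeal]
  exact congrArg _ (Units.ext Algebra.norm_norm)

theorem idealNorm_idealExt (I : IdealGroup F) :
    idealNorm F E (idealExt F E I) = I ^ Module.finrank F E := by
  refine DFunLike.congr_fun (hom_ext_principal (f := (idealNorm F E).comp (idealExt F E))
    (g := powMonoidHom (Module.finrank F E)) fun x => ?_) I
  rw [MonoidHom.comp_apply, idealExt_toPrincipalIdeal, idealNorm_toPrincipalIdeal,
    powMonoidHom_apply, ← map_pow]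
  exact congrArg _ (Units.ext (Algebra.norm_algebraMap (x : F)))

theorem idealExt_idealNorm [IsGalois F E] (I : IdealGroup E) :
    idealExt F E (idealNorm F E I) = ∏ g : E ≃ₐ[F] E, galIdeal g.toRingEquiv I := by
  refine (DFunLike.congr_fun (hom_ext_principal (f := (idealExt F E).comp (idealNorm F E))
    (g := ∏ g : E ≃ₐ[F] E, (galIdeal g.toRingEquiv).toMonoidHom) fun x => ?_) I).trans
    (MonoidHom.finsetProd_apply ..)
  rw [MonoidHom.comp_apply, idealNorm_toPrincipalIdeal, idealExt_toPrincipalIdeal,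
    MonoidHom.finsetProd_apply]
  simp only [MulEquiv.toMonoidHom_eq_coe, MonoidHom.coe_coe, galIdeal_toPrincipalIdeal,
    ← map_prod]
  refine congrArg _ (Units.ext ?_)
  rw [Units.coe_prod]
  exact Algebra.norm_eq_prod_automorphisms F (x : E)

theorem galIdeal_idealExt (g : E ≃ₐ[F] E) (I : IdealGroup F) :
    galIdeal g.toRingEquiv (idealExt F E I) = idealExt F E I := by
  refine DFunLike.congr_fun (hom_ext_principal
    (f := (galIdeal g.toRingEquiv).toMonoidHom.comp (idealExt F E)) fun x => ?_) I
  rw [MonoidHom.comp_apply, idealExt_toPrincipalIdeal]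
  exact (galIdeal_toPrincipalIdeal ..).trans (congrArg _ (Units.ext (g.commutes x)))

end Identities

section Galois

variable (F E : Type*) [Field F] [Field E] [NumberField E] [Algebra F E]

/-- The action of `Gal(E/F)` on the ideals of `E` as a homomorphism. -/
def galIdealHom : (E ≃ₐ[F] E) →* MulAut (IdealGroup E) where
  toFun g := galIdeal g.toRingEquiv
  map_one' := MulEquiv.toMonoidHom_injective (hom_ext_principal fun x =>
    galIdeal_toPrincipalIdeal _ x)
  map_mul' g h := MulEquiv.toMonoidHom_injective (hom_ext_principal fun x =>
    (galIdeal_toPrincipalIdeal _ x).trans (by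
      simp only [MulEquiv.toMonoidHom_eq_coe, MonoidHom.coe_coe, MulAut.mul_apply,
        galIdeal_toPrincipalIdeal]
      rfl))

variable {F E}

theorem mem_ambiguousIdeals_iff_of_forall_mem_zpowers {σ : E ≃ₐ[F] E}
    (hσ : ∀ g, g ∈ Subgroup.zpowers σ) {I : IdealGroup E} :
    I ∈ ambiguousIdeals F E ↔ galIdeal σ.toRingEquiv I = I := by
  refine ⟨fun h => h σ, fun h g => ?_⟩
  have hle : Subgroup.zpowers σ ≤
      (MulAction.stabilizer (MulAut (IdealGroup E)) I).comap (galIdealHom F E) :=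
    Subgroup.zpowers_le.2 h
  exact hle (hσ g)

theorem galIdeal_mem_ambiguousIdeals [CharZero F] [Normal ℚ F] (τ : E ≃ₐ[ℚ] E) {I : IdealGroup E}
    (hI : I ∈ ambiguousIdeals F E) : galIdeal τ.toRingEquiv I ∈ ambiguousIdeals F E := by
  intro g
  let g' : E ≃ₐ[ℚ] E := τ⁻¹ * g.restrictScalars ℚ * τ
  have hg' (x : F) : g' (algebraMap F E x) = algebraMap F E x := by
    change τ.symm (g (τ (algebraMap F E x))) = algebraMap F E x
    rw [← AlgEquiv.restrictNormal_commutes, g.commutes, AlgEquiv.restrictNormal_commutes,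
      AlgEquiv.symm_apply_apply]
  have hg'I : galIdealHom ℚ E g' I = I := hI (AlgEquiv.ofRingEquiv (f := g'.toRingEquiv) hg')
  have hconj : g.restrictScalars ℚ * τ = τ * g' := by simp only [g', mul_assoc, mul_inv_cancel_left]
  change galIdealHom ℚ E (g.restrictScalars ℚ) (galIdealHom ℚ E τ I) = galIdealHom ℚ E τ I
  rw [← MulAut.mul_apply, ← map_mul, hconj, map_mul, MulAut.mul_apply, hg'I]

variable [NumberField F]

theorem extendedIdeals_le_ambiguousIdeals : extendedIdeals F E ≤ ambiguousIdeals F E := by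
  rintro _ ⟨J, rfl⟩ g
  exact galIdeal_idealExt F E g J

theorem idealExt_idealNorm_of_mem_ambiguousIdeals [IsGalois F E] {I : IdealGroup E}
    (hI : I ∈ ambiguousIdeals F E) :
    idealExt F E (idealNorm F E I) = I ^ Module.finrank F E := by
  rw [idealExt_idealNorm, Finset.prod_congr rfl fun g _ => hI g, Finset.prod_const,
    Finset.card_univ, ← Nat.card_eq_fintype_card, IsGalois.card_aut_eq_finrank]

end Galois

section Index

theorem isUnit_of_sq_add_self_add_one_eq_zero {R : Type*} [Ring R] {s : R}
    (hs : s ^ 2 + s + 1 = 0) : IsUnit s := by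
  have h : s * -(s + 1) = 1 := by
    rw [← sub_eq_zero, ← neg_eq_zero, ← hs]
    noncomm_ring
  have h' : -(s + 1) * s = s * -(s + 1) := by noncomm_ring
  exact isUnit_iff_exists.2 ⟨-(s + 1), h, h'.trans h⟩

theorem sq_sub_one_of_sq_add_self_add_one_eq_zero {R : Type*} [Ring R] {s : R}
    (hs : s ^ 2 + s + 1 = 0) : (s - 1) ^ 2 = (-3 : ℤ) • s := by
  rw [← sub_eq_zero, ← hs]
  noncomm_ring

section Free

variable {M : Type*} [AddCommGroup M] [Module.Free ℤ M]

theorem natAbs_det_eq_index_range [Module.Finite ℤ M] {f : Module.End ℤ M}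
    (hf : Function.Injective f) :
    (LinearMap.det f).natAbs = f.toAddMonoidHom.range.index :=
  Submodule.natAbs_det_equiv (LinearMap.range f) (LinearEquiv.ofInjective f hf)

theorem injective_sub_one {s : Module.End ℤ M} (hs : s ^ 2 + s + 1 = 0) :
    Function.Injective ⇑(s - 1) := by
  have hinj : Function.Injective ⇑((s - 1) ^ 2 : Module.End ℤ M) := by
    rw [sq_sub_one_of_sq_add_self_add_one_eq_zero hs]
    exact (smul_right_injective M (by norm_num : (-3 : ℤ) ≠ 0)).comp
      ((Module.End.isUnit_iff s).1 (isUnit_of_sq_add_self_add_one_eq_zero hs)).1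
  rw [pow_two, Module.End.coe_mul] at hinj
  exact hinj.of_comp

theorem sq_index_range_sub_one [Module.Finite ℤ M] {s : Module.End ℤ M}
    (hs : s ^ 2 + s + 1 = 0) :
    (s - 1).toAddMonoidHom.range.index ^ 2 = 3 ^ Module.finrank ℤ M := by
  have hdet : (LinearMap.det s).natAbs = 1 := Int.isUnit_iff_natAbs_eq.1
    ((isUnit_of_sq_add_self_add_one_eq_zero hs).map LinearMap.det)
  rw [← natAbs_det_eq_index_range (injective_sub_one hs), ← Int.natAbs_pow, ← map_pow,
    sq_sub_one_of_sq_add_self_add_one_eq_zero hs, LinearMap.det_smul, Int.natAbs_mul, hdet,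
    mul_one, Int.natAbs_pow]
  rfl

end Free

variable {A M : Type*} [CommGroup A] [CommGroup M]

theorem index_range_eq_card_ker_mul {π : A →* M} (hπ : Function.Surjective π) [Finite π.ker]
    {f : A →* A} {f' : M →* M} (hf : π.comp f = f'.comp π) (hf' : Function.Injective f') :
    f.range.index = Nat.card f.ker * f'.range.index := by
  have hcomap : π.ker.comap f = π.ker := by
    rw [MonoidHom.comap_ker, hf, ← MonoidHom.comap_ker, (MonoidHom.ker_eq_bot_iff f').2 hf']
    exact MonoidHom.comap_bot π
  have hker : f.ker ≤ π.ker := hcomap ▸ MonoidHom.ker_le_comap f π.ker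
  have hquot : f'.range.index = (f.range ⊔ π.ker).index := by
    have hmap : f.range.map π = f'.range := by
      rw [MonoidHom.map_range, hf, MonoidHom.range_comp, MonoidHom.range_eq_top.2 hπ,
        ← MonoidHom.range_eq_map]
    rw [← hmap, Subgroup.index_map, MonoidHom.range_eq_top.2 hπ, Subgroup.index_top, mul_one]
  have hrel : f.range.relIndex π.ker = Nat.card f.ker := by
    have hinf : f.range ⊓ π.ker = π.ker.map f := by
      rw [← Subgroup.map_comap_eq, hcomap]
    have h1 := Subgroup.relIndex_mul_relIndex ⊥ f.ker π.ker bot_le hker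
    have h2 := Subgroup.relIndex_mul_relIndex ⊥ (π.ker.map f) π.ker bot_le (hinf ▸ inf_le_right)
    rw [Subgroup.relIndex_bot_left, Subgroup.relIndex_bot_left, Subgroup.relIndex_ker] at h1
    rw [Subgroup.relIndex_bot_left, Subgroup.relIndex_bot_left, ← h1, mul_comm] at h2
    rw [← Subgroup.inf_relIndex_right, hinf]
    have : Finite (π.ker.map f) := inferInstanceAs (Finite (f '' π.ker))
    exact Nat.eq_of_mul_eq_mul_right Nat.card_pos h2
  rw [hquot, ← hrel, ← Subgroup.relIndex_sup_left, Subgroup.relIndex_mul_index le_sup_left]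

/-- The endomorphism `x ↦ g x / x`, whose kernel is the group of fixed points of `g`. -/
def coboundary (g : A →* A) : A →* A := g / MonoidHom.id A

theorem coboundary_apply (g : A →* A) (x : A) : coboundary g x = g x / x := rfl

theorem mem_ker_coboundary {g : A →* A} {x : A} : x ∈ (coboundary g).ker ↔ g x = x := by
  rw [MonoidHom.mem_ker, coboundary_apply, div_eq_one]

theorem comp_coboundary {f : A →* M} {g : A →* A} {g' : M →* M} (h : f.comp g = g'.comp f) :
    f.comp (coboundary g) = (coboundary g').comp f := by
  ext x
  simp only [MonoidHom.comp_apply, coboundary_apply, map_div]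
  rw [← MonoidHom.comp_apply, h, MonoidHom.comp_apply]

theorem coboundary_injective_and_sq_index [Module.Free ℤ (Additive M)]
    [Module.Finite ℤ (Additive M)] {g : M →* M} (hg : ∀ x, x * g x * g (g x) = 1) :
    Function.Injective (coboundary g) ∧
      (coboundary g).range.index ^ 2 = 3 ^ Module.finrank ℤ (Additive M) := by
  let s : Module.End ℤ (Additive M) := (MonoidHom.toAdditive g).toIntLinearMap
  have hs : s ^ 2 + s + 1 = 0 := by
    refine LinearMap.ext fun x => Eq.trans ?_ (congrArg Additive.ofMul (hg x.toMul))
    rw [mul_comm, mul_comm x.toMul, ← mul_assoc]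
    rfl
  have hindex := sq_index_range_sub_one hs
  have hcob : (s - 1).toAddMonoidHom = MonoidHom.toAdditive (coboundary g) :=
    AddMonoidHom.ext fun x => rfl
  rw [hcob] at hindex
  exact ⟨injective_sub_one hs, hindex⟩

theorem sq_index_range_coboundary [Finite (CommGroup.torsion A)]
    [Module.Free ℤ (Additive (A ⧸ CommGroup.torsion A))]
    [Module.Finite ℤ (Additive (A ⧸ CommGroup.torsion A))] {g : A →* A}
    (hg : ∀ x, x * g x * g (g x) ∈ CommGroup.torsion A) :
    (coboundary g).range.index ^ 2 = Nat.card (coboundary g).ker ^ 2 *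
      3 ^ Module.finrank ℤ (Additive (A ⧸ CommGroup.torsion A)) := by
  let g' : A ⧸ CommGroup.torsion A →* A ⧸ CommGroup.torsion A :=
    QuotientGroup.map _ _ g fun x hx =>
      (CommGroup.mem_torsion _).2 (g.isOfFinOrder ((CommGroup.mem_torsion _).1 hx))
  obtain ⟨hinj, hindex⟩ := coboundary_injective_and_sq_index (g := g') fun x => by
    obtain ⟨u, rfl⟩ := QuotientGroup.mk_surjective x
    exact (QuotientGroup.eq_one_iff _).2 (hg u)
  have : Finite (QuotientGroup.mk' (CommGroup.torsion A)).ker := by rwa [QuotientGroup.ker_mk']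
  rw [index_range_eq_card_ker_mul (QuotientGroup.mk'_surjective (CommGroup.torsion A))
    (comp_coboundary (g' := g') (MonoidHom.ext fun x => rfl)) hinj, mul_pow, hindex]

end Index

section Hilbert90

variable {K L : Type*} [Field K] [Field L] [Algebra K L] {σ : L ≃ₐ[K] L}

theorem linearIndependent_pow_algEquiv :
    LinearIndependent L fun i : Fin (orderOf σ) => ((σ ^ (i : ℕ) : L ≃ₐ[K] L) : L → L) := by
  refine (linearIndependent_monoidHom L L).comp
    (fun i : Fin (orderOf σ) => ((σ ^ (i : ℕ) : L ≃ₐ[K] L) : L →* L)) fun i j hij => ?_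
  exact Fin.ext (pow_injOn_Iio_orderOf i.2 j.2
    (AlgEquiv.ext fun x => DFunLike.congr_fun hij x))

variable [FiniteDimensional K L]

theorem exists_sum_mul_pow_ne_zero {a : ℕ → L} (ha : a 0 ≠ 0) :
    ∃ c, ∑ i ∈ Finset.range (orderOf σ), a i * (σ ^ i) c ≠ 0 := by
  by_contra! hzero
  have hzero' : ∑ i : Fin (orderOf σ), a i • ((σ ^ (i : ℕ) : L ≃ₐ[K] L) : L → L) = 0 := by
    ext c
    rw [Finset.sum_apply, Pi.zero_apply, ← hzero c, Finset.sum_range]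
    rfl
  exact ha (Fintype.linearIndependent_iff.1 (linearIndependent_pow_algEquiv (σ := σ))
    (fun i => a i) hzero' ⟨0, orderOf_pos σ⟩)

theorem exists_mul_map_eq_self {u : L}
    (hu : ∏ i ∈ Finset.range (orderOf σ), (σ ^ i) u = 1) : ∃ y : Lˣ, u * σ y = y := by
  let a (i : ℕ) : L := ∏ j ∈ Finset.range i, (σ ^ j) u
  have ha0 : a 0 = 1 := rfl
  obtain ⟨c, hc⟩ := exists_sum_mul_pow_ne_zero (σ := σ) (a := a) one_ne_zero
  refine ⟨Units.mk0 _ hc, ?_⟩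
  have hshift (i : ℕ) : u * σ (a i * (σ ^ i) c) = a (i + 1) * (σ ^ (i + 1)) c := by
    have ha : u * σ (a i) = a (i + 1) := by
      simp only [a, map_prod, Finset.prod_range_succ', ← AlgEquiv.mul_apply, ← pow_succ',
        pow_zero, AlgEquiv.one_apply, mul_comm u]
    rw [map_mul, ← mul_assoc, ha, pow_succ', AlgEquiv.mul_apply]
  have hlast : a (orderOf σ) * (σ ^ orderOf σ) c = a 0 * (σ ^ 0) c := by
    rw [pow_orderOf_eq_one, pow_zero, ha0]
    exact congrArg (· * c) hu
  simp only [Units.val_mk0, map_sum, Finset.mul_sum, hshift]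
  rw [← add_left_inj (a 0 * (σ ^ 0) c), ← Finset.sum_range_succ' fun i => a i * (σ ^ i) c,
    Finset.sum_range_succ, hlast]

variable [IsGalois K L] (hσ : ∀ g, g ∈ Subgroup.zpowers σ)
include hσ

theorem algebraMap_norm_eq_prod_range (x : L) :
    algebraMap K L (Algebra.norm K x) = ∏ i ∈ Finset.range (orderOf σ), (σ ^ i) x := by
  classical
  rw [Algebra.norm_eq_prod_automorphisms, ← IsCyclic.image_range_orderOf hσ, Finset.prod_image]
  simpa only [Finset.coe_range] using pow_injOn_Iio_orderOf (x := σ)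

theorem mem_range_algebraMap_iff_of_forall_mem_zpowers {x : L} :
    x ∈ Set.range (algebraMap K L) ↔ σ x = x := by
  rw [IsGalois.mem_range_algebraMap_iff_fixed]
  refine ⟨fun h => h σ, fun h g => ?_⟩
  have hle : Subgroup.zpowers σ ≤ MulAction.stabilizer (L ≃ₐ[K] L) x := Subgroup.zpowers_le.2 h
  exact hle (hσ g)

theorem ker_coboundary_units :
    (coboundary (Units.map (σ : L →* L))).ker = (Units.map (algebraMap K L : K →* L)).range := by
  ext x
  rw [mem_ker_coboundary, Units.ext_iff]
  refine (mem_range_algebraMap_iff_of_forall_mem_zpowers hσ).symm.trans ⟨?_, ?_⟩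
  · rintro ⟨y, hy⟩
    exact ⟨Units.mk0 y fun hy0 => x.ne_zero (by rw [← hy, hy0, map_zero]), Units.ext hy⟩
  · rintro ⟨y, rfl⟩
    exact ⟨y, rfl⟩

theorem range_coboundary_units :
    (coboundary (Units.map (σ : L →* L))).range = (Units.map (Algebra.norm K : L →* K)).ker := by
  refine le_antisymm ?_ fun u hu => ?_
  · rintro _ ⟨x, rfl⟩
    rw [MonoidHom.mem_ker, coboundary_apply, map_div, div_eq_one]
    exact Units.ext (Algebra.norm_eq_of_algEquiv σ (x : L))
  · have hnorm : Algebra.norm K ((u⁻¹ : Lˣ) : L) = 1 := congrArg Units.val (inv_mem hu)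
    obtain ⟨y, hy⟩ := exists_mul_map_eq_self (σ := σ) (u := (u⁻¹ : Lˣ)) (by
      rw [← algebraMap_norm_eq_prod_range hσ, hnorm, map_one])
    refine ⟨y, ?_⟩
    rw [coboundary_apply, div_eq_iff_eq_mul, ← inv_mul_eq_iff_eq_mul]
    exact Units.ext hy

end Hilbert90

section AmbiguousPrincipal

variable {k₀ k : Type*} [Field k₀] [Field k] [NumberField k] [Algebra k₀ k]
  {σ : k ≃ₐ[k₀] k}

theorem ker_toPrincipalIdeal_le_comap_coboundary :
    (toPrincipalIdeal (𝓞 k) k).ker ≤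
      (toPrincipalIdeal (𝓞 k) k).ker.comap (coboundary (Units.map (σ : k →* k))) := by
  intro x hx
  have hσx := galIdeal_toPrincipalIdeal σ.toRingEquiv x
  rw [MonoidHom.mem_ker.1 hx, map_one] at hσx
  rw [Subgroup.mem_comap, coboundary_apply]
  exact div_mem hσx.symm hx

variable (hσ : ∀ g, g ∈ Subgroup.zpowers σ)
include hσ

theorem ambiguousPrincipalIdeals_eq_map :
    ambiguousPrincipalIdeals k₀ k = ((toPrincipalIdeal (𝓞 k) k).ker.comap
      (coboundary (Units.map (σ : k →* k)))).map (toPrincipalIdeal (𝓞 k) k) := by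
  have hmem (x : kˣ) : toPrincipalIdeal (𝓞 k) k x ∈ ambiguousIdeals k₀ k ↔
      coboundary (Units.map (σ : k →* k)) x ∈ (toPrincipalIdeal (𝓞 k) k).ker := by
    rw [mem_ambiguousIdeals_iff_of_forall_mem_zpowers hσ, galIdeal_toPrincipalIdeal,
      MonoidHom.mem_ker, coboundary_apply, map_div, div_eq_one]
    rfl
  ext I
  constructor
  · rintro ⟨⟨x, rfl⟩, hx⟩
    exact ⟨x, (hmem x).1 hx, rfl⟩
  · rintro ⟨x, hx, rfl⟩
    exact ⟨⟨x, rfl⟩, (hmem x).2 hx⟩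

variable [NumberField k₀] [IsGalois k₀ k]

theorem extendedPrincipalIdeals_eq_map :
    extendedPrincipalIdeals k₀ k =
      (coboundary (Units.map (σ : k →* k))).ker.map (toPrincipalIdeal (𝓞 k) k) := by
  rw [extendedPrincipalIdeals, principalIdeals, ker_coboundary_units hσ, MonoidHom.map_range,
    MonoidHom.map_range]
  exact congrArg _ (MonoidHom.ext (idealExt_toPrincipalIdeal k₀ k))

theorem relIndex_extendedPrincipalIdeals_ambiguousPrincipalIdeals :
    (extendedPrincipalIdeals k₀ k).relIndex (ambiguousPrincipalIdeals k₀ k) =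
      ((toPrincipalIdeal (𝓞 k) k).ker.map (coboundary (Units.map (σ : k →* k)))).relIndex
        ((Units.map (Algebra.norm k₀ : k →* k₀)).ker ⊓ (toPrincipalIdeal (𝓞 k) k).ker) := by
  rw [← range_coboundary_units hσ, ← Subgroup.map_comap_eq, Subgroup.relIndex_map_map,
    extendedPrincipalIdeals_eq_map hσ, ambiguousPrincipalIdeals_eq_map hσ,
    Subgroup.relIndex_map_map, sup_eq_left.2 ker_toPrincipalIdeal_le_comap_coboundary,
    sup_eq_left.2 (MonoidHom.ker_le_comap _ _), sup_comm]

end AmbiguousPrincipal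

section Units

variable (k₀ k : Type*) [Field k₀] [Field k] [Algebra k₀ k]

/-- The inclusion of the units of the ring of integers in the multiplicative group of the field. -/
def unitIncl : (𝓞 k)ˣ →* kˣ := Units.map (algebraMap (𝓞 k) k : 𝓞 k →* k)

theorem unitIncl_injective : Function.Injective (unitIncl k) :=
  Units.map_injective (FaithfulSMul.algebraMap_injective (𝓞 k) k)

/-- The inclusion of unit groups `E_{k₀} → E_k`. -/
def unitExt : (𝓞 k₀)ˣ →* (𝓞 k)ˣ := Units.map (algebraMap (𝓞 k₀) (𝓞 k) : 𝓞 k₀ →* 𝓞 k)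

theorem unitExt_injective : Function.Injective (unitExt k₀ k) :=
  Units.map_injective (FaithfulSMul.algebraMap_injective (𝓞 k₀) (𝓞 k))

variable {k₀ k} {σ : k ≃ₐ[k₀] k}

/-- The action of an automorphism of `k` on the unit group of `k`. -/
def galUnits (g : k ≃+* k) : (𝓞 k)ˣ →* (𝓞 k)ˣ :=
  Units.map (NumberField.RingOfIntegers.mapRingEquiv g : 𝓞 k →* 𝓞 k)

theorem unitIncl_comp_coboundary_galUnits :
    (unitIncl k).comp (coboundary (galUnits σ.toRingEquiv)) =
      (coboundary (Units.map (σ : k →* k))).comp (unitIncl k) :=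
  comp_coboundary rfl

theorem range_coboundary_galUnits_le :
    (coboundary (galUnits σ.toRingEquiv)).range ≤ (unitNorm k₀ k).ker := by
  rintro _ ⟨u, rfl⟩
  rw [MonoidHom.mem_ker, coboundary_apply, map_div, div_eq_one]
  exact unitIncl_injective k₀ (Units.ext (Algebra.norm_eq_of_algEquiv σ ((u : 𝓞 k) : k)))

variable [NumberField k]

theorem map_coboundary_ker_toPrincipalIdeal :
    (toPrincipalIdeal (𝓞 k) k).ker.map (coboundary (Units.map (σ : k →* k))) =
      (coboundary (galUnits σ.toRingEquiv)).range.map (unitIncl k) := by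
  rw [ker_toPrincipalIdeal]
  change (unitIncl k).range.map _ = _
  rw [MonoidHom.map_range, MonoidHom.map_range, unitIncl_comp_coboundary_galUnits]

theorem ker_norm_inf_ker_toPrincipalIdeal :
    (Units.map (Algebra.norm k₀ : k →* k₀)).ker ⊓ (toPrincipalIdeal (𝓞 k) k).ker =
      (unitNorm k₀ k).ker.map (unitIncl k) := by
  have hcomap : (Units.map (Algebra.norm k₀ : k →* k₀)).ker.comap (unitIncl k) =
      (unitNorm k₀ k).ker := by
    have hcomp : (Units.map (Algebra.norm k₀ : k →* k₀)).comp (unitIncl k) =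
        (unitIncl k₀).comp (unitNorm k₀ k) := rfl
    rw [MonoidHom.comap_ker, hcomp, ← MonoidHom.comap_ker,
      (MonoidHom.ker_eq_bot_iff _).2 (unitIncl_injective k₀), MonoidHom.comap_bot]
  rw [ker_toPrincipalIdeal, ← hcomap, Subgroup.map_comap_eq, inf_comm]
  rfl

variable [NumberField k₀] [IsGalois k₀ k] (hσ : ∀ g, g ∈ Subgroup.zpowers σ)
include hσ

theorem ker_coboundary_galUnits :
    (coboundary (galUnits σ.toRingEquiv)).ker = (unitExt k₀ k).range := by
  apply le_antisymm
  · intro u hu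
    have hu' : unitIncl k u ∈ (coboundary (Units.map (σ : k →* k))).ker := by
      rw [MonoidHom.mem_ker, ← MonoidHom.comp_apply, ← unitIncl_comp_coboundary_galUnits,
        MonoidHom.comp_apply, MonoidHom.mem_ker.1 hu, map_one]
    rw [ker_coboundary_units hσ] at hu'
    obtain ⟨y, hy⟩ := hu'
    have hyk : toPrincipalIdeal (𝓞 k₀) k₀ y = 1 := by
      refine idealExt_injective k₀ k ?_
      rw [idealExt_toPrincipalIdeal, hy, map_one, ← MonoidHom.mem_ker, ker_toPrincipalIdeal]
      exact ⟨u, rfl⟩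
    rw [← MonoidHom.mem_ker, ker_toPrincipalIdeal] at hyk
    obtain ⟨v, rfl⟩ := hyk
    exact ⟨v, unitIncl_injective k hy⟩
  · rintro _ ⟨v, rfl⟩
    exact mem_ker_coboundary.2
      (unitIncl_injective k (Units.ext (σ.commutes ((v : 𝓞 k₀) : k₀))))

theorem sq_index_range_coboundary_galUnits [Finite (𝓞 k₀)ˣ] (h3 : orderOf σ = 3) :
    (coboundary (galUnits σ.toRingEquiv)).range.index ^ 2 =
      Nat.card (𝓞 k₀)ˣ ^ 2 * 3 ^ NumberField.Units.rank k := by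
  have hfin : Finite (CommGroup.torsion (𝓞 k)ˣ) :=
    inferInstanceAs (Finite (NumberField.Units.torsion k))
  have hfree : Module.Free ℤ (Additive ((𝓞 k)ˣ ⧸ CommGroup.torsion (𝓞 k)ˣ)) :=
    .of_basis (NumberField.Units.basisModTorsion k)
  have hfinite : Module.Finite ℤ (Additive ((𝓞 k)ˣ ⧸ CommGroup.torsion (𝓞 k)ˣ)) :=
    .of_basis (NumberField.Units.basisModTorsion k)
  have hnorm (u : (𝓞 k)ˣ) : u * galUnits σ.toRingEquiv u *
      galUnits σ.toRingEquiv (galUnits σ.toRingEquiv u) = unitExt k₀ k (unitNorm k₀ k u) := by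
    refine unitIncl_injective k (Units.ext ?_)
    have h := algebraMap_norm_eq_prod_range hσ ((u : 𝓞 k) : k)
    rw [h3, Finset.prod_range_succ, Finset.prod_range_succ, Finset.prod_range_one] at h
    exact h.symm
  rw [sq_index_range_coboundary fun u => (CommGroup.mem_torsion _).2 (hnorm u ▸
      (unitExt k₀ k).isOfFinOrder (isOfFinOrder_of_finite _)), ker_coboundary_galUnits hσ,
    ← Nat.card_congr (MonoidHom.ofInjective (unitExt_injective k₀ k)).toEquiv]
  exact congrArg (_ * 3 ^ ·) (NumberField.Units.finrank_modTorsion k)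

theorem sq_relIndex_range_coboundary_galUnits [Finite (𝓞 k₀)ˣ] (h3 : orderOf σ = 3) :
    (coboundary (galUnits σ.toRingEquiv)).range.relIndex (unitNorm k₀ k).ker ^ 2 =
      unitNormIndex k₀ k ^ 2 * 3 ^ NumberField.Units.rank k := by
  have hle := Subgroup.relIndex_mul_index (range_coboundary_galUnits_le (σ := σ))
  have hpos : 0 < Nat.card (unitNorm k₀ k).range ^ 2 := pow_pos Nat.card_pos 2
  refine Nat.eq_of_mul_eq_mul_right hpos ?_
  rw [← mul_pow, ← Subgroup.index_ker, hle, sq_index_range_coboundary_galUnits hσ h3,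
    ← Subgroup.card_mul_index (unitNorm k₀ k).range, unitNormIndex, Subgroup.index_ker]
  ring

theorem sq_relIndex_ambiguousPrincipalIdeals [Finite (𝓞 k₀)ˣ] (h3 : orderOf σ = 3) :
    (extendedPrincipalIdeals k₀ k).relIndex (ambiguousPrincipalIdeals k₀ k) ^ 2 =
      unitNormIndex k₀ k ^ 2 * 3 ^ NumberField.Units.rank k := by
  rw [relIndex_extendedPrincipalIdeals_ambiguousPrincipalIdeals hσ,
    map_coboundary_ker_toPrincipalIdeal, ker_norm_inf_ker_toPrincipalIdeal,
    Subgroup.relIndex_map_map_of_injective _ _ (unitIncl_injective k),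
    sq_relIndex_range_coboundary_galUnits hσ h3]

end Units

section Orbits

theorem exists_disjoint_image_union_of_involutive {α : Type*} {e : α → α}
    (he : Function.Involutive e) {X : Set α} (hX : Set.MapsTo e X X) :
    ∃ Y ⊆ X, Disjoint Y (e '' Y) ∧ {x ∈ X | e x ≠ x} = Y ∪ e '' Y := by
  classical
  let _ : LinearOrder α := linearOrderOfSTO WellOrderingRel
  refine ⟨{x ∈ X | x < e x}, fun x hx => hx.1, ?_, Set.ext fun x => ⟨?_, ?_⟩⟩
  · rw [Set.disjoint_left]
    rintro _ hx ⟨y, hy, rfl⟩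
    exact lt_asymm hy.2 (by simpa only [he y] using hx.2)
  · rintro ⟨hx, hne⟩
    rcases lt_or_gt_of_ne hne with hlt | hlt
    · exact Or.inr ⟨e x, ⟨hX hx, by rwa [he x]⟩, he x⟩
    · exact Or.inl ⟨hx, hlt⟩
  · rintro (hx | ⟨y, hy, rfl⟩)
    · exact ⟨hx.1, hx.2.ne'⟩
    · exact ⟨hX hy.1, by simpa only [he y] using hy.2.ne⟩

end Orbits

section Primes

open scoped Pointwise

variable {F : Type*} [Field F] [NumberField F]

theorem galPrime_asIdeal_eq_smul (g : F ≃ₐ[ℚ] F) (v : HeightOneSpectrum (𝓞 F)) :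
    (galPrime g.toRingEquiv v).asIdeal = g • v.asIdeal :=
  (Ideal.map_comap_of_equiv _).symm

theorem galPrime_under (g : F ≃ₐ[ℚ] F) (v : HeightOneSpectrum (𝓞 F)) :
    (galPrime g.toRingEquiv v).asIdeal.under ℤ = v.asIdeal.under ℤ := by
  rw [galPrime_asIdeal_eq_smul]
  exact (Ideal.LiesOver.over (p := v.asIdeal.under ℤ)).symm

theorem galPrime_involutive {g : F ≃ₐ[ℚ] F} (hg : g * g = 1) :
    Function.Involutive (galPrime g.toRingEquiv) := by
  intro v
  apply HeightOneSpectrum.ext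
  rw [galPrime_asIdeal_eq_smul, galPrime_asIdeal_eq_smul, smul_smul, hg, one_smul]

variable {E : Type*} [Field E] [NumberField E] [Algebra F E]

theorem mem_ramifiedPrimes_of_under_eq [IsGalois ℚ F] [IsGalois ℚ E]
    {v w : HeightOneSpectrum (𝓞 F)} (hvw : v.asIdeal.under ℤ = w.asIdeal.under ℤ)
    (hv : v ∈ ramifiedPrimes F E) : w ∈ ramifiedPrimes F E := by
  obtain ⟨P, ⟨hP, hPv⟩, hram⟩ := hv
  obtain ⟨⟨Q, hQ, hQw⟩⟩ := w.asIdeal.nonempty_primesOver (S := 𝓞 E)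
  refine ⟨Q, ⟨hQ, hQw⟩, ?_⟩
  have : w.asIdeal.LiesOver (v.asIdeal.under ℤ) := ⟨hvw⟩
  have : P.LiesOver (v.asIdeal.under ℤ) := .trans P v.asIdeal _
  have : Q.LiesOver (v.asIdeal.under ℤ) := .trans Q w.asIdeal _
  have hF : v.asIdeal.ramificationIdx ℤ = w.asIdeal.ramificationIdx ℤ :=
    Ideal.ramificationIdx_eq_of_isGaloisGroup (v.asIdeal.under ℤ) _ _ (F ≃ₐ[ℚ] F)
  have hE : P.ramificationIdx ℤ = Q.ramificationIdx ℤ :=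
    Ideal.ramificationIdx_eq_of_isGaloisGroup (v.asIdeal.under ℤ) _ _ (E ≃ₐ[ℚ] E)
  rw [Ideal.ramificationIdx_tower v.asIdeal P, Ideal.ramificationIdx_tower w.asIdeal Q, hF] at hE
  rwa [← Nat.eq_of_mul_eq_mul_left (Ideal.ramificationIdx_pos _ _) hE]

end Primes

section Quadratic

open scoped Pointwise

variable {F : Type*} [Field F] [NumberField F] [IsGalois ℚ F]

theorem eq_one_or_eq_of_finrank_eq_two (h2 : Module.finrank ℚ F = 2) {τ : F ≃ₐ[ℚ] F} (hτ : τ ≠ 1)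
    (g : F ≃ₐ[ℚ] F) : g = 1 ∨ g = τ := by
  have hcard : Nat.card (F ≃ₐ[ℚ] F) = 2 := by rw [IsGalois.card_aut_eq_finrank, h2]
  exact or_iff_not_imp_left.2 fun hg => ((Nat.card_eq_two_iff' 1).1 hcard).unique hg hτ

theorem mem_splitPrimes_iff (h2 : Module.finrank ℚ F = 2) {τ : F ≃ₐ[ℚ] F} (hτ : τ ≠ 1)
    (v : HeightOneSpectrum (𝓞 F)) : v ∈ splitPrimes F ↔ galPrime τ.toRingEquiv v ≠ v := by
  have hover : (v.asIdeal.under ℤ).primesOver (𝓞 F) =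
      {v.asIdeal, (galPrime τ.toRingEquiv v).asIdeal} := by
    ext P
    constructor
    · rintro ⟨hP, hPv⟩
      obtain ⟨g, rfl⟩ := Ideal.exists_smul_eq_of_isGaloisGroup (v.asIdeal.under ℤ) v.asIdeal P
        (F ≃ₐ[ℚ] F)
      rcases eq_one_or_eq_of_finrank_eq_two h2 hτ g with rfl | rfl
      · exact Or.inl (one_smul _ _)
      · exact Or.inr (galPrime_asIdeal_eq_smul g v).symm
    · rintro (rfl | rfl)
      · exact ⟨v.isPrime, inferInstance⟩
      · exact ⟨(galPrime τ.toRingEquiv v).isPrime, ⟨(galPrime_under τ v).symm⟩⟩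
  rw [splitPrimes, Set.mem_ofPred_eq, hover, h2]
  refine ⟨fun hcard heq => ?_,
    fun hne => Set.ncard_pair fun h => hne (HeightOneSpectrum.ext h.symm)⟩
  rw [heq, Set.insert_eq_of_mem (Set.mem_singleton _), Set.ncard_singleton] at hcard
  omega

end Quadratic

section Subgroups

theorem mem_of_pow_mem_of_coprime {G : Type*} [Group G] {H : Subgroup G} {x : G} {m n : ℕ}
    (hmn : m.Coprime n) (hm : x ^ m ∈ H) (hn : x ^ n ∈ H) : x ∈ H := by
  have hbezout := Nat.gcd_eq_gcd_ab m n
  rw [hmn.gcd_eq_one, Nat.cast_one] at hbezout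
  rw [← zpow_one x, hbezout, zpow_add, zpow_mul, zpow_mul, zpow_natCast, zpow_natCast]
  exact mul_mem (zpow_mem hm _) (zpow_mem hn _)

theorem relIndex_le_card_of_ker_inf_le {G C : Type*} [Group G] [Group C] [Finite C]
    {φ : G →* C} {H K : Subgroup G} (h : φ.ker ⊓ H ≤ K) : K.relIndex H ≤ Nat.card C := by
  have hcard : (φ.ker ⊓ H).relIndex H = Nat.card (H.map φ) := by
    rw [Subgroup.inf_relIndex_right, Subgroup.relIndex_ker]
  calc K.relIndex H ≤ (φ.ker ⊓ H).relIndex H :=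
        Subgroup.relIndex_le_of_le_left h (hcard ▸ Nat.card_pos.ne')
    _ = Nat.card (H.map φ) := hcard
    _ ≤ Nat.card C := Subgroup.card_le_card_group _

end Subgroups

section NormOrder

variable (k₀ : Type*) {k : Type*} [Field k₀] [NumberField k₀] [Field k] [NumberField k]
  [Algebra k₀ k]

theorem extendedIdeals_eq_extendedPrincipalIdeals [IsPrincipalIdealRing (𝓞 k₀)] :
    extendedIdeals k₀ k = extendedPrincipalIdeals k₀ k := by
  rw [extendedIdeals, extendedPrincipalIdeals, principalIdeals,
    MonoidHom.range_eq_top.2 toPrincipalIdeal_surjective, ← MonoidHom.range_eq_map]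

/-- The orders modulo `n` of the relative norm `N_{k/k₀}(𝔞)` at the primes of a set `S`. -/
def normOrd (n : ℕ) (S : Set (HeightOneSpectrum (𝓞 k₀))) :
    IdealGroup k →* Multiplicative (S → ZMod n) where
  toFun I := Multiplicative.ofAdd fun v => (ord v.1 (idealNorm k₀ k I) : ZMod n)
  map_one' := Multiplicative.toAdd.injective (funext fun v => by
    change ((ord v.1 (idealNorm k₀ k 1) : ℤ) : ZMod n) = 0
    rw [map_one, ord_one, Int.cast_zero])
  map_mul' I J := Multiplicative.toAdd.injective (funext fun v => by
    change ((ord v.1 (idealNorm k₀ k (I * J)) : ℤ) : ZMod n) =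
      (ord v.1 (idealNorm k₀ k I) : ℤ) + (ord v.1 (idealNorm k₀ k J) : ℤ)
    rw [map_mul, ord_mul, Int.cast_add])

variable {k₀}

theorem mem_ker_normOrd {n : ℕ} {S : Set (HeightOneSpectrum (𝓞 k₀))} {I : IdealGroup k} :
    I ∈ (normOrd k₀ n S).ker ↔ ∀ v ∈ S, (n : ℤ) ∣ ord v (idealNorm k₀ k I) := by
  rw [MonoidHom.mem_ker, ← Multiplicative.toAdd.injective.eq_iff, funext_iff, Subtype.forall]
  exact forall₂_congr fun v _ => ZMod.intCast_zmod_eq_zero_iff_dvd _ n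

theorem relIndex_le_pow_ncard {G : Type*} [Group G] {H K : Subgroup G} (f : G →* IdealGroup k)
    {n : ℕ} (hn : n ≠ 0) {S : Set (HeightOneSpectrum (𝓞 k₀))} (hS : S.Finite)
    (h : ∀ x ∈ H, (∀ v ∈ S, (n : ℤ) ∣ ord v (idealNorm k₀ k (f x))) → x ∈ K) :
    K.relIndex H ≤ n ^ S.ncard := by
  have : NeZero n := ⟨hn⟩
  have : Finite S := hS
  have : Finite (Multiplicative (S → ZMod n)) := inferInstanceAs (Finite (S → ZMod n))
  have hcard : Nat.card (Multiplicative (S → ZMod n)) = n ^ S.ncard := by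
    rw [Nat.card_congr Multiplicative.toAdd, Nat.card_fun, Nat.card_zmod, Nat.card_coe_set_eq]
  rw [← hcard]
  exact relIndex_le_card_of_ker_inf_le (φ := (normOrd k₀ n S).comp f)
    fun x hx => h x hx.2 (mem_ker_normOrd.1 hx.1)

theorem mem_extendedIdeals_of_dvd_ord [IsGalois k₀ k] {I : IdealGroup k}
    (hI : I ∈ ambiguousIdeals k₀ k) (h : ∀ v ∈ ramifiedPrimes k₀ k,
      (Module.finrank k₀ k : ℤ) ∣ ord v (idealNorm k₀ k I)) : I ∈ extendedIdeals k₀ k := by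
  have hpow := idealExt_idealNorm_of_mem_ambiguousIdeals hI
  have hdvd (v : HeightOneSpectrum (𝓞 k₀)) :
      (Module.finrank k₀ k : ℤ) ∣ ord v (idealNorm k₀ k I) := by
    by_cases hv : v ∈ ramifiedPrimes k₀ k
    · exact h v hv
    · exact dvd_ord_of_idealExt_eq_pow k₀ k hv hpow
  have hn : Module.finrank k₀ k ≠ 0 := Module.finrank_pos.ne'
  obtain ⟨J, hJ⟩ := exists_pow_eq_of_dvd_ord hn _ hdvd
  refine ⟨J, pow_left_injective hn ?_⟩
  change idealExt k₀ k J ^ _ = I ^ _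
  rw [← hpow, ← hJ, map_pow]

end NormOrder

section Compositum

variable {k : Type*} [Field k] [NumberField k]

theorem idealNorm_idealExt_of_linearDisjoint {A B : IntermediateField ℚ k}
    (hAB : A.LinearDisjoint B) (hsup : A ⊔ B = ⊤) (I : IdealGroup B) :
    idealNorm A k (idealExt B k I) = idealExt ℚ A (idealNorm ℚ B I) := by
  refine DFunLike.congr_fun (hom_ext_principal (f := (idealNorm A k).comp (idealExt B k))
    (g := (idealExt ℚ A).comp (idealNorm ℚ B)) fun x => ?_) I
  rw [MonoidHom.comp_apply, MonoidHom.comp_apply, idealExt_toPrincipalIdeal,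
    idealNorm_toPrincipalIdeal, idealNorm_toPrincipalIdeal, idealExt_toPrincipalIdeal]
  exact congrArg _ (Units.ext (hAB.norm_algebraMap hsup x))

variable {L k₀ : IntermediateField ℚ k}

theorem extendedPrincipalIdeals_le_absoluteAmbiguousPrincipalIdeals :
    extendedPrincipalIdeals ℚ L ≤ absoluteAmbiguousPrincipalIdeals k₀ L k := by
  rintro _ ⟨J, hJ, rfl⟩
  refine ⟨idealExt_mem_principalIdeals ℚ L hJ, ?_⟩
  change idealExt L k (idealExt ℚ L J) ∈ ambiguousIdeals k₀ k
  rw [idealExt_idealExt, ← idealExt_idealExt ℚ k₀]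
  exact extendedIdeals_le_ambiguousIdeals ⟨_, rfl⟩

variable [IsGalois k₀ k] (hL : L.LinearDisjoint k₀) (hsup : L ⊔ k₀ = ⊤)
include hL hsup

theorem pow_finrank_eq_idealExt_idealNorm {I : IdealGroup L}
    (hI : idealExt L k I ∈ ambiguousIdeals k₀ k) :
    I ^ Module.finrank k₀ k = idealExt ℚ L (idealNorm ℚ L I) := by
  apply idealExt_injective L k
  rw [map_pow, ← idealExt_idealNorm_of_mem_ambiguousIdeals hI,
    idealNorm_idealExt_of_linearDisjoint hL.symm (sup_comm L k₀ ▸ hsup), idealExt_idealExt,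
    idealExt_idealExt]

theorem pow_finrank_mem_extendedPrincipalIdeals {I : IdealGroup L}
    (hI : I ∈ absoluteAmbiguousPrincipalIdeals k₀ L k) :
    I ^ Module.finrank k₀ k ∈ extendedPrincipalIdeals ℚ L := by
  rw [pow_finrank_eq_idealExt_idealNorm hL hsup hI.2]
  exact ⟨_, idealNorm_mem_principalIdeals ℚ L hI.1, rfl⟩

end Compositum

section Compositum

theorem relativeAmbiguousPrincipalIdeals_eq (k₀ L k : Type*) [Field k₀] [Field L] [NumberField L]
    [Field k] [NumberField k] [Algebra k₀ k] [Algebra L k] :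
    relativeAmbiguousPrincipalIdeals k₀ L k = ambiguousPrincipalIdeals k₀ k ⊓
      (extendedPrincipalIdeals ℚ L).comap (idealNorm L k) := by
  have : IsPrincipalIdealRing (𝓞 ℚ) := .of_surjective Rat.ringOfIntegersEquiv.symm
    Rat.ringOfIntegersEquiv.symm.surjective
  rw [relativeAmbiguousPrincipalIdeals, ← MonoidHom.comap_ker, QuotientGroup.ker_mk',
    extendedIdeals_eq_extendedPrincipalIdeals]

theorem idealNorm_mem_absoluteAmbiguousPrincipalIdeals {k₀ L k : Type*} [Field k₀] [CharZero k₀]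
    [Normal ℚ k₀] [Field L] [NumberField L] [Field k] [NumberField k] [Algebra k₀ k] [Algebra L k]
    [IsGalois L k] {I : IdealGroup k} (hI : I ∈ ambiguousPrincipalIdeals k₀ k) :
    idealNorm L k I ∈ absoluteAmbiguousPrincipalIdeals k₀ L k := by
  refine ⟨idealNorm_mem_principalIdeals L k hI.1, ?_⟩
  change idealExt L k (idealNorm L k I) ∈ ambiguousIdeals k₀ k
  rw [idealExt_idealNorm]
  exact Subgroup.prod_mem _ fun g _ => galIdeal_mem_ambiguousIdeals (g.restrictScalars ℚ) hI.2

variable {k : Type*} [Field k] [NumberField k] {L k₀ : IntermediateField ℚ k}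
  (hL : L.LinearDisjoint k₀) (hsup : L ⊔ k₀ = ⊤)
include hL hsup

theorem idealNorm_mem_extendedPrincipalIdeals {I : IdealGroup k}
    (hI : I ∈ extendedPrincipalIdeals k₀ k) : idealNorm L k I ∈ extendedPrincipalIdeals ℚ L := by
  obtain ⟨J, hJ, rfl⟩ := hI
  rw [idealNorm_idealExt_of_linearDisjoint hL hsup]
  exact ⟨_, idealNorm_mem_principalIdeals ℚ k₀ hJ, rfl⟩

theorem extendedPrincipalIdeals_le_relativeAmbiguousPrincipalIdeals :
    extendedPrincipalIdeals k₀ k ≤ relativeAmbiguousPrincipalIdeals k₀ L k := by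
  rw [relativeAmbiguousPrincipalIdeals_eq]
  intro I hI
  refine ⟨?_, idealNorm_mem_extendedPrincipalIdeals hL hsup hI⟩
  obtain ⟨J, hJ, rfl⟩ := hI
  exact ⟨idealExt_mem_principalIdeals k₀ k hJ, extendedIdeals_le_ambiguousIdeals ⟨J, rfl⟩⟩

variable [IsGalois ℚ k] [IsGalois ℚ k₀]

theorem map_idealNorm_sup_extendedPrincipalIdeals
    (hcop : (Module.finrank L k).Coprime (Module.finrank k₀ k)) :
    (ambiguousPrincipalIdeals k₀ k).map (idealNorm L k) ⊔ extendedPrincipalIdeals ℚ L =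
      absoluteAmbiguousPrincipalIdeals k₀ L k := by
  apply le_antisymm
  · refine sup_le ?_ extendedPrincipalIdeals_le_absoluteAmbiguousPrincipalIdeals
    rintro _ ⟨I, hI, rfl⟩
    exact idealNorm_mem_absoluteAmbiguousPrincipalIdeals hI
  · intro I hI
    refine mem_of_pow_mem_of_coprime hcop (Subgroup.mem_sup_left ?_) (Subgroup.mem_sup_right ?_)
    · exact ⟨idealExt L k I, ⟨idealExt_mem_principalIdeals L k hI.1, hI.2⟩,
        idealNorm_idealExt L k I⟩
    · exact pow_finrank_mem_extendedPrincipalIdeals hL hsup hI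

theorem relIndex_absolute_mul_relIndex_relative
    (hcop : (Module.finrank L k).Coprime (Module.finrank k₀ k)) :
    (extendedPrincipalIdeals ℚ L).relIndex (absoluteAmbiguousPrincipalIdeals k₀ L k) *
      (extendedPrincipalIdeals k₀ k).relIndex (relativeAmbiguousPrincipalIdeals k₀ L k) =
    (extendedPrincipalIdeals k₀ k).relIndex (ambiguousPrincipalIdeals k₀ k) := by
  have hnorm : (relativeAmbiguousPrincipalIdeals k₀ L k).relIndex (ambiguousPrincipalIdeals k₀ k) =
      (extendedPrincipalIdeals ℚ L).relIndex (absoluteAmbiguousPrincipalIdeals k₀ L k) := by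
    rw [relativeAmbiguousPrincipalIdeals_eq, Subgroup.inf_relIndex_left, Subgroup.relIndex_comap,
      ← map_idealNorm_sup_extendedPrincipalIdeals hL hsup hcop, Subgroup.relIndex_sup_right]
  rw [← hnorm, mul_comm]
  exact Subgroup.relIndex_mul_relIndex _ _ _
    (extendedPrincipalIdeals_le_relativeAmbiguousPrincipalIdeals hL hsup) inf_le_left

end Compositum

section Bounds

theorem idealExt_idealNorm_of_finrank_eq_two {F : Type*} [Field F] [NumberField F] [IsGalois ℚ F]
    (h2 : Module.finrank ℚ F = 2) {τ : F ≃ₐ[ℚ] F} (hτ : τ ≠ 1) (I : IdealGroup F) :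
    idealExt ℚ F (idealNorm ℚ F I) = I * galIdeal τ.toRingEquiv I := by
  classical
  have huniv : (Finset.univ : Finset (F ≃ₐ[ℚ] F)) = {1, τ} :=
    (Finset.eq_univ_of_forall fun g => Finset.mem_insert.2 <|
      (eq_one_or_eq_of_finrank_eq_two h2 hτ g).imp_right Finset.mem_singleton.2).symm
  rw [idealExt_idealNorm, huniv, Finset.prod_pair hτ.symm]
  exact congrArg (· * galIdeal τ.toRingEquiv I)
    (DFunLike.congr_fun (map_one (galIdealHom ℚ F)) I)

variable {k : Type*} [Field k] [NumberField k] {L k₀ : IntermediateField ℚ k}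
  (hL : L.LinearDisjoint k₀) (hsup : L ⊔ k₀ = ⊤)
include hL hsup

theorem ord_galPrime_idealNorm_idealExt (τ : k₀ ≃ₐ[ℚ] k₀) (v : HeightOneSpectrum (𝓞 k₀))
    (I : IdealGroup L) : ord (galPrime τ.toRingEquiv v) (idealNorm k₀ k (idealExt L k I)) =
      ord v (idealNorm k₀ k (idealExt L k I)) := by
  rw [idealNorm_idealExt_of_linearDisjoint hL.symm (sup_comm L k₀ ▸ hsup)]
  conv_lhs => rw [← galIdeal_idealExt ℚ k₀ τ]
  exact ord_galPrime_galIdeal _ _ _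

theorem dvd_ord_add_ord_galPrime [IsGalois ℚ k₀] (h2 : Module.finrank ℚ k₀ = 2)
    {τ : k₀ ≃ₐ[ℚ] k₀} (hτ : τ ≠ 1) {I : IdealGroup k}
    (hI : I ∈ relativeAmbiguousPrincipalIdeals k₀ L k) (v : HeightOneSpectrum (𝓞 k₀)) :
    (Module.finrank k₀ k : ℤ) ∣
      ord v (idealNorm k₀ k I) + ord (galPrime τ.toRingEquiv v) (idealNorm k₀ k I) := by
  rw [relativeAmbiguousPrincipalIdeals_eq] at hI
  obtain ⟨J, -, hJ⟩ := hI.2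
  have hprod : idealNorm k₀ k I * galIdeal τ.toRingEquiv (idealNorm k₀ k I) =
      idealExt ℚ k₀ J ^ Module.finrank k₀ k := by
    rw [← idealExt_idealNorm_of_finrank_eq_two h2 hτ, idealNorm_idealNorm,
      ← idealNorm_idealNorm ℚ L, ← hJ, idealNorm_idealExt, map_pow,
      hL.finrank_right_eq_finrank hsup]
  have hord := congrArg (ord (galPrime τ.toRingEquiv v)) hprod
  rw [ord_mul, ord_galPrime_galIdeal, ord_pow] at hord
  exact ⟨_, (add_comm _ _).trans hord⟩

variable [IsPrincipalIdealRing (𝓞 k₀)]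

theorem relIndex_absolute_le [IsGalois k₀ k]
    (hcop : (Module.finrank L k).Coprime (Module.finrank k₀ k)) {τ : k₀ ≃ₐ[ℚ] k₀}
    {Y : Set (HeightOneSpectrum (𝓞 k₀))} (hY : Y ⊆ ramifiedPrimes k₀ k)
    (hdisj : Disjoint Y (galPrime τ.toRingEquiv '' Y)) :
    (extendedPrincipalIdeals ℚ L).relIndex (absoluteAmbiguousPrincipalIdeals k₀ L k) ≤
      Module.finrank k₀ k ^ (ramifiedPrimes k₀ k \ galPrime τ.toRingEquiv '' Y).ncard := by
  refine relIndex_le_pow_ncard (idealExt L k) Module.finrank_pos.ne'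
    ((ramifiedPrimes_finite k₀ k).subset Set.sdiff_subset) fun I hI hdvd => ?_
  have hext : idealExt L k I ∈ extendedPrincipalIdeals k₀ k := by
    rw [← extendedIdeals_eq_extendedPrincipalIdeals]
    refine mem_extendedIdeals_of_dvd_ord hI.2 fun v hv => ?_
    by_cases hvY : v ∈ galPrime τ.toRingEquiv '' Y
    · obtain ⟨w, hw, rfl⟩ := hvY
      rw [ord_galPrime_idealNorm_idealExt hL hsup]
      exact hdvd w ⟨hY hw, Set.disjoint_left.1 hdisj hw⟩
    · exact hdvd v ⟨hv, hvY⟩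
  refine mem_of_pow_mem_of_coprime hcop ?_ (pow_finrank_mem_extendedPrincipalIdeals hL hsup hI)
  rw [← idealNorm_idealExt]
  exact idealNorm_mem_extendedPrincipalIdeals hL hsup hext

theorem relIndex_relative_le [IsGalois k₀ k] [IsGalois ℚ k₀] (h2 : Module.finrank ℚ k₀ = 2)
    (hodd : Odd (Module.finrank k₀ k)) {τ : k₀ ≃ₐ[ℚ] k₀} (hτ : τ ≠ 1)
    {Y : Set (HeightOneSpectrum (𝓞 k₀))} (hY : Y ⊆ ramifiedPrimes k₀ k)
    (hcover : {v ∈ ramifiedPrimes k₀ k | galPrime τ.toRingEquiv v ≠ v} =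
      Y ∪ galPrime τ.toRingEquiv '' Y) :
    (extendedPrincipalIdeals k₀ k).relIndex (relativeAmbiguousPrincipalIdeals k₀ L k) ≤
      Module.finrank k₀ k ^ Y.ncard := by
  refine relIndex_le_pow_ncard (MonoidHom.id _) Module.finrank_pos.ne'
    ((ramifiedPrimes_finite k₀ k).subset hY) fun I hI hdvd => ?_
  rw [← extendedIdeals_eq_extendedPrincipalIdeals]
  refine mem_extendedIdeals_of_dvd_ord hI.1.2 fun v hv => ?_
  by_cases hfix : galPrime τ.toRingEquiv v = v
  · have htwo := dvd_ord_add_ord_galPrime hL hsup h2 hτ hI v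
    rw [hfix, ← two_mul] at htwo
    exact (Nat.isCoprime_iff_coprime.2 hodd.coprime_two_right).dvd_of_dvd_mul_left htwo
  · rcases hcover.subset ⟨hv, hfix⟩ with hvY | ⟨w, hw, rfl⟩
    · exact hdvd v hvY
    · exact (dvd_add_right (hdvd w hw)).1 (dvd_ord_add_ord_galPrime hL hsup h2 hτ hI w)

theorem exists_ncard_split_eq_and_relIndex_le [IsGalois ℚ k] [IsGalois ℚ k₀]
    (h2 : Module.finrank ℚ k₀ = 2) (hodd : Odd (Module.finrank k₀ k)) :
    ∃ s ≤ (ramifiedPrimes k₀ k).ncard,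
      (ramifiedPrimes k₀ k ∩ splitPrimes k₀).ncard = 2 * s ∧
      (extendedPrincipalIdeals ℚ L).relIndex (absoluteAmbiguousPrincipalIdeals k₀ L k) ≤
        Module.finrank k₀ k ^ ((ramifiedPrimes k₀ k).ncard - s) ∧
      (extendedPrincipalIdeals k₀ k).relIndex (relativeAmbiguousPrincipalIdeals k₀ L k) ≤
        Module.finrank k₀ k ^ s := by
  have hcard : Nat.card (k₀ ≃ₐ[ℚ] k₀) = 2 := by rw [IsGalois.card_aut_eq_finrank, h2]
  obtain ⟨τ, hτ, -⟩ := (Nat.card_eq_two_iff' 1).1 hcard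
  have hinv : Function.Involutive (galPrime τ.toRingEquiv) := galPrime_involutive <| by
    rw [← sq, ← hcard, pow_card_eq_one']
  have hmaps : Set.MapsTo (galPrime τ.toRingEquiv) (ramifiedPrimes k₀ k) (ramifiedPrimes k₀ k) :=
    fun v hv => mem_ramifiedPrimes_of_under_eq (galPrime_under τ v).symm hv
  obtain ⟨Y, hY, hdisj, hcover⟩ := exists_disjoint_image_union_of_involutive hinv hmaps
  have hfin := ramifiedPrimes_finite k₀ k
  have himage : (galPrime τ.toRingEquiv '' Y).ncard = Y.ncard :=
    Set.ncard_image_of_injective _ (Equiv.injective _)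
  have hsplit : ramifiedPrimes k₀ k ∩ splitPrimes k₀ = Y ∪ galPrime τ.toRingEquiv '' Y := by
    rw [← hcover]
    exact Set.ext fun v => and_congr_right fun _ => mem_splitPrimes_iff h2 hτ v
  refine ⟨Y.ncard, Set.ncard_le_ncard hY hfin, ?_, ?_,
    relIndex_relative_le hL hsup h2 hodd hτ hY hcover⟩
  · rw [hsplit, Set.ncard_union_eq hdisj (hfin.subset hY) ((hfin.subset hY).image _), himage,
      two_mul]
  · have hcop : (Module.finrank L k).Coprime (Module.finrank k₀ k) := by
      rw [hL.finrank_left_eq_finrank hsup, h2]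
      exact hodd.coprime_two_left
    have hle := relIndex_absolute_le hL hsup hcop hY hdisj
    rwa [Set.ncard_sdiff ((hmaps.mono_left hY).image_subset) ((hfin.subset hY).image _),
      himage] at hle

end Bounds

section Eisenstein

theorem pow_finrank_mem_range_unitNorm (K k : Type*) [Field K] [NumberField K] [Field k]
    [NumberField k] [Algebra K k] (u : (𝓞 K)ˣ) :
    u ^ Module.finrank K k ∈ (unitNorm K k).range :=
  ⟨unitExt K k u, unitIncl_injective K <| Units.ext <|
    Algebra.norm_algebraMap (S := k) ((u : 𝓞 K) : K)⟩

variable (K : Type*) [Field K] [NumberField K] [IsCyclotomicExtension {3} ℚ K]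

theorem finrank_rat_eq_two : Module.finrank ℚ K = 2 :=
  (IsCyclotomicExtension.finrank (n := 3) K
    (Polynomial.cyclotomic.irreducible_rat (by decide))).trans rfl

theorem exists_surjective_fin_six_units : ∃ f : Fin 6 → (𝓞 K)ˣ, Function.Surjective f :=
  ⟨_, fun u => List.mem_iff_get.1 <|
    IsCyclotomicExtension.Rat.Three.Units.mem (IsCyclotomicExtension.zeta_spec 3 ℚ K) u⟩

instance finite_units : Finite (𝓞 K)ˣ :=
  (exists_surjective_fin_six_units K).elim fun f hf => Finite.of_surjective f hf

theorem card_infinitePlace_eq_one : Fintype.card (NumberField.InfinitePlace K) = 1 := by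
  rw [NumberField.InfinitePlace.card_eq_nrRealPlaces_add_nrComplexPlaces,
    IsCyclotomicExtension.Rat.nrRealPlaces_eq_zero (n := 3) K (by decide), zero_add,
    IsCyclotomicExtension.Rat.nrComplexPlaces_eq_totient_div_two (n := 3)]
  rfl

variable (k : Type*) [Field k] [NumberField k] [Algebra K k] (h3 : Module.finrank K k = 3)
include h3

theorem exists_unitNormIndex_eq_three_pow : ∃ U ≤ 1, unitNormIndex K k = 3 ^ U := by
  have : Fact (Nat.Prime 3) := ⟨Nat.prime_three⟩
  have hp : IsPGroup 3 ((𝓞 K)ˣ ⧸ (unitNorm K k).range) := fun x => by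
    obtain ⟨u, rfl⟩ := QuotientGroup.mk_surjective x
    refine ⟨1, (QuotientGroup.eq_one_iff _).2 ?_⟩
    rw [pow_one, ← h3]
    exact pow_finrank_mem_range_unitNorm K k u
  obtain ⟨U, hU⟩ := IsPGroup.iff_card.1 hp
  obtain ⟨f, hf⟩ := exists_surjective_fin_six_units K
  have hle : Nat.card ((𝓞 K)ˣ ⧸ (unitNorm K k).range) ≤ 6 :=
    (Nat.card_le_card_of_surjective _ (QuotientGroup.mk_surjective.comp hf)).trans_eq
      (Nat.card_fin 6)
  refine ⟨U, Nat.lt_succ_iff.1 ((Nat.pow_lt_pow_iff_right (a := 3) (by norm_num)).1 ?_), hU⟩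
  omega

variable [IsGalois K k]

theorem rank_units_eq_two : NumberField.Units.rank k = 2 := by
  have := IsUnramifiedAtInfinitePlaces_of_odd_finrank (k := K) (K := k) (by rw [h3]; decide)
  rw [NumberField.Units.rank, IsUnramifiedAtInfinitePlaces.card_infinitePlace K k,
    card_infinitePlace_eq_one, h3]

theorem relIndex_ambiguousPrincipalIdeals :
    (extendedPrincipalIdeals K k).relIndex (ambiguousPrincipalIdeals K k) =
      3 * unitNormIndex K k := by
  have : Fact (Nat.Prime 3) := ⟨Nat.prime_three⟩
  have hcard : Nat.card (k ≃ₐ[K] k) = 3 := by rw [IsGalois.card_aut_eq_finrank, h3]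
  obtain ⟨σ, hσ⟩ := (isCyclic_of_prime_card hcard).exists_generator
  have horder : orderOf σ = 3 := by rw [orderOf_eq_card_of_forall_mem_zpowers hσ, hcard]
  apply Nat.pow_left_injective two_ne_zero
  change _ ^ 2 = _ ^ 2
  rw [sq_relIndex_ambiguousPrincipalIdeals hσ horder, rank_units_eq_two K k h3, mul_pow, mul_comm]

end Eisenstein

theorem PFType.existsUnique_invariants_eq {U A R : ℕ} (hU : U ≤ 1) (hA : 1 ≤ A)
    (hsum : A + R = U + 1) : ∃! T : PFType, T.invariants = (U, A, R) := by
  have hinj : Function.Injective PFType.invariants := by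
    rintro ⟨⟩ ⟨⟩ h <;> first | rfl | cases h
  have hcases : (U = 1 ∧ A = 1 ∧ R = 1) ∨ (U = 1 ∧ A = 2 ∧ R = 0) ∨ (U = 0 ∧ A = 1 ∧ R = 0) := by
    omega
  obtain ⟨T, hT⟩ : ∃ T : PFType, T.invariants = (U, A, R) := by
    rcases hcases with ⟨rfl, rfl, rfl⟩ | ⟨rfl, rfl, rfl⟩ | ⟨rfl, rfl, rfl⟩
    exacts [⟨.alpha, rfl⟩, ⟨.beta, rfl⟩, ⟨.gamma, rfl⟩]
  exact ⟨T, hT, fun S hS => hinj (hS.trans hT.symm)⟩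

section Factors

variable {k : Type*} [Field k] [NumberField k] {L k₀ : IntermediateField ℚ k}

theorem exists_card_factors_eq_three_pow [IsGalois ℚ k] [IsGalois ℚ k₀]
    [IsCyclotomicExtension {3} ℚ k₀] (hL : L.LinearDisjoint k₀) (hsup : L ⊔ k₀ = ⊤)
    (hcop : (Module.finrank L k).Coprime (Module.finrank k₀ k)) (h3 : Module.finrank k₀ k = 3)
    {U : ℕ} (hU : unitNormIndex k₀ k = 3 ^ U) :
    ∃ A R, Nat.card (AbsolutePrincipalFactors k₀ L k) = 3 ^ A ∧
      Nat.card (RelativePrincipalFactors k₀ L k) = 3 ^ R ∧ A + R = U + 1 := by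
  have hmul : Nat.card (AbsolutePrincipalFactors k₀ L k) *
      Nat.card (RelativePrincipalFactors k₀ L k) = 3 ^ (U + 1) := by
    rw [pow_succ', ← hU, ← relIndex_ambiguousPrincipalIdeals k₀ k h3]
    exact relIndex_absolute_mul_relIndex_relative hL hsup hcop
  obtain ⟨A, -, hA⟩ := (Nat.dvd_prime_pow Nat.prime_three).1 (Dvd.intro _ hmul)
  obtain ⟨R, -, hR⟩ := (Nat.dvd_prime_pow Nat.prime_three).1 (Dvd.intro_left _ hmul)
  rw [hA, hR, ← pow_add] at hmul
  exact ⟨A, R, hA, hR, Nat.pow_right_injective le_add_self hmul⟩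

theorem exists_exponents [IsGalois ℚ k] [IsCyclotomicExtension {3} ℚ k₀]
    (hL : L.LinearDisjoint k₀) (hsup : L ⊔ k₀ = ⊤) (h3 : Module.finrank k₀ k = 3) :
    ∃ U A R s : ℕ, U ≤ 1 ∧ unitNormIndex k₀ k = 3 ^ U ∧
      Nat.card (AbsolutePrincipalFactors k₀ L k) = 3 ^ A ∧
      Nat.card (RelativePrincipalFactors k₀ L k) = 3 ^ R ∧
      A + R = U + 1 ∧ (ramifiedPrimes k₀ k ∩ splitPrimes k₀).ncard = 2 * s ∧
      A + s ≤ (ramifiedPrimes k₀ k).ncard ∧ R ≤ s := by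
  have : IsGalois ℚ k₀ := IsCyclotomicExtension.isGalois {3} ℚ k₀
  have : IsPrincipalIdealRing (𝓞 k₀) := IsCyclotomicExtension.Rat.three_pid k₀
  have h2 : Module.finrank ℚ k₀ = 2 := finrank_rat_eq_two k₀
  have hL2 : Module.finrank L k = 2 := (hL.finrank_left_eq_finrank hsup).trans h2
  obtain ⟨U, hU1, hU⟩ := exists_unitNormIndex_eq_three_pow k₀ k h3
  obtain ⟨A, R, hA, hR, hsum⟩ :=
    exists_card_factors_eq_three_pow hL hsup (by rw [hL2, h3]; decide) h3 hU
  obtain ⟨s, hst, hs, hAbs, hRel⟩ :=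
    exists_ncard_split_eq_and_relIndex_le hL hsup h2 (by rw [h3]; decide)
  have hAs : A ≤ (ramifiedPrimes k₀ k).ncard - s := by
    rw [← Nat.pow_le_pow_iff_right (a := 3) (by decide), ← hA, ← h3]
    exact hAbs
  have hRs : R ≤ s := by
    rw [← Nat.pow_le_pow_iff_right (a := 3) (by decide), ← hR, ← h3]
    exact hRel
  exact ⟨U, A, R, s, hU1, hU, hA, hR, hsum, hs, by omega, hRs⟩

end Factors

section Radical

theorem rat_pow_ne_of_not_prime_pow_dvd {d n : ℕ} (hd : 1 < d) (hn : n ≠ 0)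
    (h : ∀ p : ℕ, p.Prime → ¬ p ^ n ∣ d) (q : ℚ) : q ^ n ≠ d := by
  intro hq
  have hint : IsIntegral ℤ q := .of_pow hn.pos (hq ▸ isIntegral_natCast d)
  obtain ⟨z, rfl⟩ := IsIntegrallyClosed.isIntegral_iff.1 hint
  have hz : z.natAbs ^ n = d := by
    rw [eq_intCast] at hq
    rw [← Int.natAbs_pow, show z ^ n = d by exact_mod_cast hq, Int.natAbs_natCast]
  obtain ⟨p, hp, hpz⟩ := Nat.exists_prime_and_dvd (n := z.natAbs) fun hone => by
    rw [hone, one_pow] at hz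
    exact hd.ne hz
  exact h p hp (hz ▸ pow_dvd_pow_of_dvd hpz n)

section Field

variable {F E : Type*} [Field F] [Field E] [Algebra F E] {n : ℕ} {d : F} {θ ζ : E}

theorem finrank_adjoin_radical (hn : n.Prime) (hd : ∀ q : F, q ^ n ≠ d)
    (hθ : θ ^ n = algebraMap F E d) :
    Module.finrank F (IntermediateField.adjoin F {θ}) = n := by
  have hmonic := Polynomial.monic_X_pow_sub_C d hn.ne_zero
  have hroot : Polynomial.aeval θ (Polynomial.X ^ n - Polynomial.C d) = 0 := by
    rw [map_sub, map_pow, Polynomial.aeval_X, Polynomial.aeval_C, hθ, sub_self]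
  rw [IntermediateField.adjoin.finrank ⟨_, hmonic, hroot⟩,
    ← minpoly.eq_of_irreducible_of_monic (X_pow_sub_C_irreducible_of_prime hn hd) hroot hmonic,
    Polynomial.natDegree_X_pow_sub_C]

theorem isGalois_of_adjoin_radical_eq_top [NeZero (n : F)] (hd : d ≠ 0)
    (hθ : θ ^ n = algebraMap F E d) (hζ : IsPrimitiveRoot ζ n)
    (htop : IntermediateField.adjoin F {θ, ζ} = ⊤) : IsGalois F E := by
  have hn : n ≠ 0 := (NeZero.of_neZero_natCast F).ne
  have hθ0 : θ ≠ 0 := by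
    rintro rfl
    rw [zero_pow hn] at hθ
    exact hd ((algebraMap F E).injective (by rw [← hθ, map_zero]))
  let f : Polynomial F := Polynomial.X ^ n - Polynomial.C d
  have hroot {x : E} (hx : x ^ n = algebraMap F E d) : x ∈ f.rootSet E := by
    rw [Polynomial.mem_rootSet_of_ne (Polynomial.X_pow_sub_C_ne_zero hn.pos d)]
    simp only [map_sub, map_pow, Polynomial.aeval_X, Polynomial.aeval_C, hx, sub_self]
  have hζθ : (ζ * θ) ^ n = algebraMap F E d := by rw [mul_pow, hζ.pow_eq_one, one_mul, hθ]
  have hadjoin : IntermediateField.adjoin F (f.rootSet E) = ⊤ := by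
    rw [eq_top_iff, ← htop, IntermediateField.adjoin_le_iff]
    have hmem {x : E} (hx : x ^ n = algebraMap F E d) :
        x ∈ IntermediateField.adjoin F (f.rootSet E) :=
      IntermediateField.subset_adjoin _ _ (hroot hx)
    rintro x (rfl | rfl)
    · exact hmem hθ
    · rw [← mul_div_cancel_right₀ x hθ0]
      exact div_mem (hmem hζθ) (hmem hθ)
  have hsplit : (f.map (algebraMap F E)).Splits := by
    simp only [f, Polynomial.map_sub, Polynomial.map_pow, Polynomial.map_X, Polynomial.map_C]
    exact X_pow_sub_C_splits_of_isPrimitiveRoot hζ hθ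
  have : Polynomial.IsSplittingField F E f :=
    isSplittingField_iff_intermediateField.2 ⟨hsplit, hadjoin⟩
  exact .of_separable_splitting_field (Polynomial.separable_X_pow_sub_C d (NeZero.ne (n : F)) hd)

end Field

theorem eq_or_eq_neg_of_toPrincipalIdeal_eq {x y : ℚˣ}
    (h : toPrincipalIdeal (𝓞 ℚ) ℚ x = toPrincipalIdeal (𝓞 ℚ) ℚ y) : x = y ∨ x = -y := by
  obtain ⟨u, hu⟩ : x / y ∈ (Units.map (algebraMap (𝓞 ℚ) ℚ : 𝓞 ℚ →* ℚ)).range := by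
    rw [← ker_toPrincipalIdeal, MonoidHom.mem_ker, map_div, h, div_self']
  let e : (𝓞 ℚ)ˣ ≃* ℤˣ := Units.mapEquiv Rat.ringOfIntegersEquiv.toMulEquiv
  have hunit : u = 1 ∨ u = -1 := (Int.units_eq_one_or (e u)).imp
    (fun h1 => e.injective (h1.trans (map_one e).symm))
    (fun h1 => e.injective (h1.trans (Units.ext (by simp [e])).symm))
  rcases hunit with rfl | rfl
  · exact Or.inl (div_eq_one.1 (hu.symm.trans (map_one _)))
  · right
    rw [← neg_one_mul, ← div_eq_iff_eq_mul, ← hu]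
    exact Units.ext (by simp)

theorem mem_ambiguousIdeals_of_pow_mem {F E : Type*} [Field F] [Field E] [NumberField E]
    [Algebra F E] {I : IdealGroup E} {n : ℕ} (hn : n ≠ 0) (hI : I ^ n ∈ ambiguousIdeals F E) :
    I ∈ ambiguousIdeals F E := fun g =>
  pow_left_injective hn ((map_pow (galIdeal g.toRingEquiv) I n).symm.trans (hI g))

section PrincipalRadical

variable {L : Type*} [Field L] [NumberField L] {n : ℕ} {d : ℚˣ} {ϑ : Lˣ}
  (hϑ : ϑ ^ n = Units.map (algebraMap ℚ L : ℚ →* L) d)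
include hϑ

theorem toPrincipalIdeal_pow_eq_idealExt :
    toPrincipalIdeal (𝓞 L) L ϑ ^ n = idealExt ℚ L (toPrincipalIdeal (𝓞 ℚ) ℚ d) := by
  rw [← map_pow, hϑ, idealExt_toPrincipalIdeal]

theorem toPrincipalIdeal_notMem_extendedPrincipalIdeals (hn : Odd n)
    (hd : ∀ q : ℚ, q ^ n ≠ d) :
    toPrincipalIdeal (𝓞 L) L ϑ ∉ extendedPrincipalIdeals ℚ L := by
  rintro ⟨_, ⟨q, rfl⟩, hq⟩
  have hpow : toPrincipalIdeal (𝓞 ℚ) ℚ (q ^ n) = toPrincipalIdeal (𝓞 ℚ) ℚ d :=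
    idealExt_injective ℚ L <| by
      rw [map_pow, map_pow, hq, toPrincipalIdeal_pow_eq_idealExt hϑ]
  rcases eq_or_eq_neg_of_toPrincipalIdeal_eq hpow with h | h
  · exact hd q (congrArg Units.val h)
  · refine hd (-q) ?_
    rw [hn.neg_pow, neg_eq_iff_eq_neg]
    exact congrArg Units.val h

end PrincipalRadical

variable {k : Type*} [Field k] [NumberField k] {L k₀ : IntermediateField ℚ k}

theorem exists_orderOf_eq_of_pow_eq {n : ℕ} (hn : n.Prime) (hodd : Odd n) {d : ℚ}
    (hd : ∀ q : ℚ, q ^ n ≠ d) {θ : k} (hθ : θ ^ n = d) (hθL : θ ∈ L) :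
    ∃ (ϑ : Lˣ) (x : absoluteAmbiguousPrincipalIdeals k₀ L k), ((ϑ : L) : k) = θ ∧
      (x : IdealGroup L) = toPrincipalIdeal (𝓞 L) L ϑ ∧
      orderOf (QuotientGroup.mk x : AbsolutePrincipalFactors k₀ L k) = n := by
  have hd0 : d ≠ 0 := fun h => hd 0 (by rw [h, zero_pow hn.ne_zero])
  have hθ0 : θ ≠ 0 := by
    rintro rfl
    rw [zero_pow hn.ne_zero] at hθ
    exact hd0 (by exact_mod_cast hθ.symm)
  let ϑ : Lˣ := Units.mk0 ⟨θ, hθL⟩ fun h => hθ0 (congrArg Subtype.val h)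
  have hϑ : ϑ ^ n = Units.map (algebraMap ℚ L : ℚ →* L) (Units.mk0 d hd0) :=
    Units.ext (Subtype.ext (hθ.trans (eq_ratCast (algebraMap ℚ k) d).symm))
  have hpow : toPrincipalIdeal (𝓞 L) L ϑ ^ n ∈ extendedPrincipalIdeals ℚ L :=
    ⟨_, ⟨_, rfl⟩, (toPrincipalIdeal_pow_eq_idealExt hϑ).symm⟩
  have hmem : toPrincipalIdeal (𝓞 L) L ϑ ∈ absoluteAmbiguousPrincipalIdeals k₀ L k := by
    refine ⟨⟨ϑ, rfl⟩, mem_ambiguousIdeals_of_pow_mem hn.ne_zero ?_⟩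
    rw [← map_pow]
    exact (extendedPrincipalIdeals_le_absoluteAmbiguousPrincipalIdeals hpow).2
  have : Fact n.Prime := ⟨hn⟩
  refine ⟨ϑ, ⟨_, hmem⟩, rfl, rfl, orderOf_eq_prime ((QuotientGroup.eq_one_iff _).2 hpow) ?_⟩
  rw [Ne, QuotientGroup.eq_one_iff]
  exact toPrincipalIdeal_notMem_extendedPrincipalIdeals hϑ hodd hd

end Radical

end PureCubic

end

theorem theorem2p1_general {k : Type*} [Field k] [NumberField k]
    (d : ℚ) (hd : ∀ q : ℚ, q ^ 3 ≠ d)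
    (θ ζ : k) (hθ : θ ^ 3 = (d : k)) (hζ : IsPrimitiveRoot ζ 3)
    (L k₀ : IntermediateField ℚ k)
    (hL : L = IntermediateField.adjoin ℚ {θ}) (hk₀ : k₀ = IntermediateField.adjoin ℚ {ζ})
    (hk : IntermediateField.adjoin ℚ {θ, ζ} = ⊤) :
    ∃ U A R t s : ℕ,
      PureCubic.unitNormIndex k₀ k = 3 ^ U ∧
      Nat.card (PureCubic.AbsolutePrincipalFactors k₀ L k) = 3 ^ A ∧
      Nat.card (PureCubic.RelativePrincipalFactors k₀ L k) = 3 ^ R ∧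
      (PureCubic.ramifiedPrimes k₀ k).Finite ∧
      (PureCubic.ramifiedPrimes k₀ k).ncard = t ∧
      (PureCubic.ramifiedPrimes k₀ k ∩ PureCubic.splitPrimes k₀).ncard = 2 * s ∧
      (∃! T : PureCubic.PFType, T.invariants = (U, A, R)) ∧
      A + R = U + 1 ∧
      (1 ≤ A + R ∧ A + R ≤ t) ∧
      (1 ≤ A ∧ (A : ℤ) ≤ (t : ℤ) - (s : ℤ)) ∧
      (0 ≤ R ∧ R ≤ s) ∧
      ∃ (ϑ : Lˣ) (x : PureCubic.absoluteAmbiguousPrincipalIdeals k₀ L k),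
        ((ϑ : L) : k) = θ ∧
        (x : PureCubic.IdealGroup L) = toPrincipalIdeal (𝓞 L) L ϑ ∧
        Nat.card (Subgroup.zpowers
          (QuotientGroup.mk x : PureCubic.AbsolutePrincipalFactors k₀ L k)) = 3 := by
  have hθ' : θ ^ 3 = algebraMap ℚ k d := hθ.trans (eq_ratCast (algebraMap ℚ k) d).symm
  have hL3 : Module.finrank ℚ L = 3 := hL ▸ PureCubic.finrank_adjoin_radical Nat.prime_three hd hθ'
  have : IsCyclotomicExtension {3} ℚ k₀ := hk₀ ▸ hζ.intermediateField_adjoin_isCyclotomicExtension ℚ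
  have h2 : Module.finrank ℚ k₀ = 2 := PureCubic.finrank_rat_eq_two k₀
  have hsup : L ⊔ k₀ = ⊤ := by rw [hL, hk₀, ← IntermediateField.adjoin_union, ← hk]; rfl
  have hdisj : L.LinearDisjoint k₀ := .of_finrank_coprime (by rw [hL3, h2]; decide)
  have : IsGalois ℚ k := PureCubic.isGalois_of_adjoin_radical_eq_top
    (fun h => hd 0 (by rw [h, zero_pow three_ne_zero])) hθ' hζ hk
  obtain ⟨U, A, R, s, hU1, hU, hA, hR, hsum, hs, hAs, hRs⟩ := PureCubic.exists_exponents hdisj hsup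
    ((hdisj.finrank_right_eq_finrank hsup).trans hL3)
  obtain ⟨ϑ, x, hϑ, hx, horder⟩ := PureCubic.exists_orderOf_eq_of_pow_eq (L := L) (k₀ := k₀)
    Nat.prime_three (by decide) hd hθ (hL ▸ IntermediateField.mem_adjoin_simple_self ℚ θ)
  have hA1 : 1 ≤ A := Nat.one_le_iff_ne_zero.2 <| by
    rintro rfl
    exact absurd (horder ▸ hA ▸ orderOf_dvd_natCard _) (by decide : ¬ 3 ∣ 3 ^ 0)
  exact ⟨U, A, R, _, s, hU, hA, hR, PureCubic.ramifiedPrimes_finite k₀ k, rfl, hs,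
    PureCubic.PFType.existsUnique_invariants_eq hU1 hA1 hsum, hsum, by omega, by omega, by omega,
    ϑ, x, hϑ, hx, (Nat.card_zpowers _).trans horder⟩

theorem theorem2p1 {k : Type*} [Field k] [NumberField k]
    (d : ℕ) (hd : 1 < d) (hcubefree : ∀ p : ℕ, p.Prime → ¬ p ^ 3 ∣ d)
    (θ ζ : k) (hθ : θ ^ 3 = (d : k)) (hζ : IsPrimitiveRoot ζ 3)
    (L k₀ : IntermediateField ℚ k)
    (hL : L = IntermediateField.adjoin ℚ {θ}) (hk₀ : k₀ = IntermediateField.adjoin ℚ {ζ})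
    (hk : IntermediateField.adjoin ℚ {θ, ζ} = ⊤) :
    ∃ U A R t s : ℕ,
      PureCubic.unitNormIndex k₀ k = 3 ^ U ∧
      Nat.card (PureCubic.AbsolutePrincipalFactors k₀ L k) = 3 ^ A ∧
      Nat.card (PureCubic.RelativePrincipalFactors k₀ L k) = 3 ^ R ∧
      (PureCubic.ramifiedPrimes k₀ k).Finite ∧
      (PureCubic.ramifiedPrimes k₀ k).ncard = t ∧
      (PureCubic.ramifiedPrimes k₀ k ∩ PureCubic.splitPrimes k₀).ncard = 2 * s ∧
      (∃! T : PureCubic.PFType, T.invariants = (U, A, R)) ∧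
      A + R = U + 1 ∧
      (1 ≤ A + R ∧ A + R ≤ t) ∧
      (1 ≤ A ∧ (A : ℤ) ≤ (t : ℤ) - (s : ℤ)) ∧
      (0 ≤ R ∧ R ≤ s) ∧
      ∃ (ϑ : Lˣ) (x : PureCubic.absoluteAmbiguousPrincipalIdeals k₀ L k),
        ((ϑ : L) : k) = θ ∧
        (x : PureCubic.IdealGroup L) = toPrincipalIdeal (𝓞 L) L ϑ ∧
        Nat.card (Subgroup.zpowers
          (QuotientGroup.mk x : PureCubic.AbsolutePrincipalFactors k₀ L k)) = 3 :=
  theorem2p1_general d (PureCubic.rat_pow_ne_of_not_prime_pow_dvd hd three_ne_zero hcubefree) θ ζ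
    (by exact_mod_cast hθ) hζ L k₀ hL hk₀ hk
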